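/- Let $d\ge 1$. Let $\mathcal M_d$ be the set of positive semidefinite complex $d\times d$ matrices of trace one and $\mathcal M'_d\supseteq\mathcal M_d$ the set of all Hermitian $d\times d$ matrices of trace one. Let $\{E_x\}_{x\in X}$ be a POVM on $\mathbb C^d$ with a discrete or continuous outcome set $X$, given by a measurable density with respect to a measure $\mu$: $E_x\ge 0$ and $\int_X E_x\,d\mu(x)=\mathbb 1$ (for discrete $X$, $\mu$ is the counting measure). Outcomes $x_1,x_2,\dots$ of measurements on independent copies of a true state $\rho_0\in\mathcal M_d$ are i.i.d. with density $\mathrm{Tr}(\rho_0E_x)$. The likelihood is $\mathcal L(\sigma)=\prod_{i=1}^N\mathrm{Tr}(\sigma E_{x_i})$, and an ML estimate over a model $\mathcal M\subseteq\mathcal M'_d$ is a maximizer of $\mathcal L$ over those $\sigma\in\mathcal M$ with $\mathrm{Tr}(\sigma E_{x_i})\ge 0$ for $i=1,\dots,N$. The Fisher information at $\rho_0$ is the form $$\mathcal I(h,k)=\int_X\frac{\mathrm{Tr}(hE_x)\,\mathrm{Tr}(kE_x)}{\mathrm{Tr}(\rho_0E_x)}\,d\mu(x),$$ where, in $\mathcal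 I(h,h)$, $0/0=0$ and $a/0=+\infty$ for $a>0$. A model $\mathcal M\subseteq\mathcal M'_d$ satisfies LAN at $\rho_0\in\mathcal M$ if $0<\mathcal I(h,h)<\infty$ for all nonzero $h$ in its tangent space at $\rho_0$ and there are measurable functions $\hat\rho_N$ of $x_1,\dots,x_N$ such that, as $N\to\infty$: 1. with probability tending to one, $\hat\rho_N$ is the unique ML estimate over $\mathcal M$; 2. $\sqrt N(\hat\rho_N-\rho_0)$ converges in distribution to the centred Gaussian law on the tangent space with covariance $\mathcal I^{-1}$; 3. for all $R$ and all $\varepsilon>0$, with probability tending to one, every $\rho\in\mathcal M$ with $N\,\mathrm{Tr}[(\rho-\hat\rho_N)^2]\le R^2$ has $\mathrm{Tr}(\rho E_{x_i})>0$ for $i\le N$ and $\left|\log\mathcal L(\rho)-\log\mathcal L(\hat\rho_N)+\tfrac N2\,\mathcal I(\rho-\hat\rho_N,\rho-\hat\rho_N)\right|\le\varepsilon$. A model $\mathcal M$ satisfies MP-LAN at $\rho_0\in\mathcal M$ if $\mathcal M$ is convex and is contained in a model $\mathcal M'$ that satisfies LAN at $\rho_0$. **Lemma.** The set $\mathcal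 M_d$ is convex and contained in $\mathcal M'_d$, and for all data the likelihood $\mathcal L$ is twice continuously differentiable. For every $\rho_0\in\mathcal M_d$ (of full rank or not) at which the Fisher information is finite and nonsingular, i.e. $0<\mathcal I(h,h)<\infty$ for all nonzero traceless Hermitian $h$, the unconstrained model $\mathcal M'_d$ satisfies LAN at $\rho_0$, and hence $\mathcal M_d$ satisfies MP-LAN at $\rho_0$. -/

import Mathlib

open MeasureTheory ProbabilityTheory Filter Topology
open scoped ENNReal ComplexOrder

noncomputable section

namespace QuantumTomography

/-- Complex `d × d` matrices carry the product (= Borel) σ-algebra of their entries. -/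
instance instMeasurableSpaceMat (d : ℕ) : MeasurableSpace (Matrix (Fin d) (Fin d) ℂ) :=
  inferInstanceAs (MeasurableSpace (Fin d → Fin d → ℂ))

instance instBorelSpaceMat (d : ℕ) : BorelSpace (Matrix (Fin d) (Fin d) ℂ) :=
  inferInstanceAs (BorelSpace (Fin d → Fin d → ℂ))

/-- The quantum state space `M_d`: positive semidefinite `d × d` matrices of trace one. -/
def quantumStates (d : ℕ) : Set (Matrix (Fin d) (Fin d) ℂ) :=
  {ρ | ρ.PosSemidef ∧ ρ.trace = 1}

/-- The unconstrained model `M'_d`: all Hermitian `d × d` matrices of trace one. -/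
def traceOneHermitian (d : ℕ) : Set (Matrix (Fin d) (Fin d) ℂ) :=
  {σ | σ.IsHermitian ∧ σ.trace = 1}

/-- A positive operator-valued measure on `ℂ^d`, given by its density `x ↦ E_x` with respect to
a reference measure on the space `X` of outcomes: the effects `E_x` are positive semidefinite
and sum (integrate) to the identity. For a discrete outcome set the reference measure is the
counting measure; a continuous outcome set is allowed as well. -/
structure POVM (d : ℕ) (X : Type*) [MeasurableSpace X] where
  refMeasure : Measure X
  effect : X → Matrix (Fin d) (Fin d) ℂ
  measurable_effect : Measurable effect
  posSemidef_effect : ∀ x, (effect x).PosSemidef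
  integrable_effect : ∀ i j, Integrable (fun x => effect x i j) refMeasure
  integral_effect : ∀ i j, ∫ x, effect x i j ∂refMeasure = (1 : Matrix (Fin d) (Fin d) ℂ) i j

namespace POVM

variable {d : ℕ} {X : Type*} [MeasurableSpace X] (E : POVM d X)

/-- The Born rule `Tr(σ E_x)`. The trace is real whenever `σ` is Hermitian. The same expression
is used for tangent vectors `h` in place of `σ`. -/
def born (σ : Matrix (Fin d) (Fin d) ℂ) (x : X) : ℝ := (σ * E.effect x).trace.re

/-- The distribution of one measurement outcome on the state `ρ`: the Born rule is its density. -/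
def law (ρ : Matrix (Fin d) (Fin d) ℂ) : Measure X :=
  E.refMeasure.withDensity fun x => ENNReal.ofReal (E.born ρ x)

open scoped MatrixOrder Matrix.Norms.L2Operator in
theorem born_nonneg (ρ : quantumStates d) (x : X) : 0 ≤ E.born ρ x := by
  obtain ⟨ρ, hρ, -⟩ := ρ
  obtain ⟨B, rfl⟩ := CStarAlgebra.nonneg_iff_eq_star_mul_self.mp hρ.nonneg
  have h := ((E.posSemidef_effect x).mul_mul_conjTranspose_same B).trace_nonneg
  have h2 : (B * E.effect x * B.conjTranspose).trace
      = (star B * B * E.effect x).trace := by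
    rw [Matrix.trace_mul_comm, ← Matrix.mul_assoc]; rfl
  rw [h2] at h
  exact (Complex.le_def.mp h).1

theorem integrable_trace (σ : Matrix (Fin d) (Fin d) ℂ) :
    Integrable (fun x => (σ * E.effect x).trace) E.refMeasure := by
  simp only [Matrix.trace, Matrix.diag, Matrix.mul_apply]
  exact integrable_finsetSum _ fun i _ => integrable_finsetSum _ fun j _ =>
    (E.integrable_effect j i).const_mul _

theorem integral_born (σ : Matrix (Fin d) (Fin d) ℂ) :
    ∫ x, E.born σ x ∂E.refMeasure = σ.trace.re := by
  have h : ∫ x, (σ * E.effect x).trace ∂E.refMeasure = σ.trace := by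
    simp only [Matrix.trace, Matrix.diag, Matrix.mul_apply]
    have h1 : ∀ i j, Integrable (fun x => σ i j * E.effect x j i) E.refMeasure :=
      fun i j => (E.integrable_effect j i).const_mul _
    refine (integral_finsetSum _ fun i _ => integrable_finsetSum _ fun j _ => h1 i j).trans ?_
    refine Finset.sum_congr rfl fun i _ => ?_
    refine (integral_finsetSum _ fun j _ => h1 i j).trans ?_
    simp [integral_const_mul, E.integral_effect, Matrix.one_apply]
  rw [← h]
  exact integral_re (E.integrable_trace σ)

theorem law_univ (ρ : quantumStates d) : E.law ρ Set.univ = 1 := by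
  have hi : Integrable (E.born ρ) E.refMeasure := (E.integrable_trace ρ).re
  rw [law, withDensity_apply _ MeasurableSet.univ, Measure.restrict_univ,
    ← ofReal_integral_eq_lintegral_ofReal hi
      (Eventually.of_forall fun x => E.born_nonneg ρ x), E.integral_born, ρ.2.2]
  simp

instance isProbabilityMeasure_law (ρ : quantumStates d) :
    IsProbabilityMeasure (E.law (ρ : Matrix (Fin d) (Fin d) ℂ)) :=
  ⟨E.law_univ ρ⟩

/-- The joint law of an infinite sequence of outcomes of independent measurements on identically
prepared copies of `ρ`. The data for sample size `N` are its first `N` terms. -/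
def sampleLaw (ρ : quantumStates d) : Measure (ℕ → X) :=
  Measure.infinitePi fun _ => E.law (ρ : Matrix (Fin d) (Fin d) ℂ)

instance isProbabilityMeasure_sampleLaw (ρ : quantumStates d) :
    IsProbabilityMeasure (E.sampleLaw ρ) := by
  unfold sampleLaw; infer_instance

/-- The likelihood `L(σ) = ∏ᵢ Tr(σ E_{xᵢ})` of `σ` given the outcomes `x₁, …, x_N`. Collecting
equal outcomes, this is `∏ⱼ Tr(σ Eⱼ) ^ nⱼ` with `nⱼ` the number of times that `j` was observed. -/
def likelihood {N : ℕ} (x : Fin N → X) (σ : Matrix (Fin d) (Fin d) ℂ) : ℝ :=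
  ∏ i, E.born σ (x i)

/-- `σ` is a maximum likelihood estimate over the model `M`: it maximizes the likelihood among
those elements of `M` that give no observed outcome a negative Born-rule value (that is, over the
effective domain of the convex function `-log L`). The last restriction is void if `M` consists
of density matrices. -/
def IsMLE (M : Set (Matrix (Fin d) (Fin d) ℂ)) {N : ℕ} (x : Fin N → X)
    (σ : Matrix (Fin d) (Fin d) ℂ) : Prop :=
  (σ ∈ M ∧ ∀ i, 0 ≤ E.born σ (x i)) ∧
    ∀ τ ∈ M, (∀ i, 0 ≤ E.born τ (x i)) → E.likelihood x τ ≤ E.likelihood x σ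

/-- The (one-sample, classical) Fisher information at `ρ` in the direction `h`, as an extended
real: the integral of `Tr(h E_x)² / Tr(ρ E_x)`, where `0 / 0 = 0` and `a / 0 = ∞` for `a > 0`. -/
def fisherInfo (ρ h : Matrix (Fin d) (Fin d) ℂ) : ℝ≥0∞ :=
  ∫⁻ x, ENNReal.ofReal (E.born h x ^ 2) / ENNReal.ofReal (E.born ρ x) ∂E.refMeasure

/-- The Fisher information as a bilinear form in two directions `h`, `k`. -/
def fisherForm (ρ h k : Matrix (Fin d) (Fin d) ℂ) : ℝ :=
  ∫ x, E.born h x * E.born k x / E.born ρ x ∂E.refMeasure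

/-- The Fisher information at `ρ` is finite and nonsingular on all directions of the
unconstrained model, i.e. on all traceless Hermitian matrices. -/
def HasRegularFisherInfo (ρ : Matrix (Fin d) (Fin d) ℂ) : Prop :=
  ∀ h : Matrix (Fin d) (Fin d) ℂ, h.IsHermitian → h.trace = 0 → h ≠ 0 →
    0 < E.fisherInfo ρ h ∧ E.fisherInfo ρ h < ∞

end POVM

section LAN

variable {d : ℕ} {X : Type*} [MeasurableSpace X]

/-- The linear tangent space of the model `M` at `ρ`. -/
def tangentSpace (M : Set (Matrix (Fin d) (Fin d) ℂ)) (ρ : Matrix (Fin d) (Fin d) ℂ) :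
    Submodule ℝ (Matrix (Fin d) (Fin d) ℂ) :=
  Submodule.span ℝ (tangentConeAt ℝ M ρ)

/-- A basis of the tangent space, used as a coordinate system. Nothing below depends on which
basis is taken. -/
def tangentBasis (M : Set (Matrix (Fin d) (Fin d) ℂ)) (ρ : Matrix (Fin d) (Fin d) ℂ) :
    Module.Basis (Fin (Module.finrank ℝ (tangentSpace M ρ))) ℝ (tangentSpace M ρ) :=
  Module.finBasis ℝ (tangentSpace M ρ)

/-- The tangent vector with given coordinates. -/
def tangentVector (M : Set (Matrix (Fin d) (Fin d) ℂ)) (ρ : Matrix (Fin d) (Fin d) ℂ)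
    (θ : EuclideanSpace ℝ (Fin (Module.finrank ℝ (tangentSpace M ρ)))) :
    Matrix (Fin d) (Fin d) ℂ :=
  ∑ i, θ i • (tangentBasis M ρ i : Matrix (Fin d) (Fin d) ℂ)

/-- The Fisher information matrix of the model `M` at `ρ`, in the coordinates `tangentBasis`. -/
def fisherMatrix (E : POVM d X) (M : Set (Matrix (Fin d) (Fin d) ℂ))
    (ρ : Matrix (Fin d) (Fin d) ℂ) :
    Matrix (Fin (Module.finrank ℝ (tangentSpace M ρ)))
      (Fin (Module.finrank ℝ (tangentSpace M ρ))) ℝ :=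
  Matrix.of fun i j => E.fisherForm ρ (tangentBasis M ρ i) (tangentBasis M ρ j)

/-- The model `M` satisfies local asymptotic normality (LAN) at the true state `ρ₀`, for
independent measurements of the POVM `E`. That is: `ρ₀` belongs to `M`, the Fisher information
`I` is finite and nonsingular on the tangent space of `M` at `ρ₀`, and there are estimators
`est N`, functions of the data of size `N`, such that
* with probability tending to one, `est N` is the unique maximum likelihood estimate over `M`;
* `√N (est N - ρ₀)` converges in distribution to the Gaussian law on the tangent space with
  mean zero and covariance matrix `I⁻¹`;
* near `est N` the likelihood is Gaussian with Hessian `N I`: for all `R` and all `ε > 0`, with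
  probability tending to one, all `ρ ∈ M` with `√N ‖ρ - est N‖ ≤ R` (Hilbert-Schmidt norm) have
  `L(ρ) = L(est N) exp (-N I(ρ - est N, ρ - est N) / 2 + r)` with `|r| ≤ ε`, all Born-rule values
  of the data being positive. -/
structure SatisfiesLAN (E : POVM d X) (M : Set (Matrix (Fin d) (Fin d) ℂ))
    (ρ₀ : quantumStates d) : Prop where
  isModel : M ⊆ traceOneHermitian d
  mem : (ρ₀ : Matrix (Fin d) (Fin d) ℂ) ∈ M
  regular : ∀ h ∈ tangentSpace M ρ₀, h ≠ 0 →
    0 < E.fisherInfo ρ₀ h ∧ E.fisherInfo ρ₀ h < ∞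
  exists_mle : ∃ est : (N : ℕ) → (Fin N → X) → Matrix (Fin d) (Fin d) ℂ,
    (∀ N, Measurable (est N)) ∧
    Tendsto (fun N : ℕ => E.sampleLaw ρ₀ {ω | ¬ (E.IsMLE M (fun i : Fin N => ω i)
        (est N fun i => ω i) ∧
      ∀ σ, E.IsMLE M (fun i : Fin N => ω i) σ → σ = est N fun i => ω i)}) atTop (𝓝 0) ∧
    TendstoInDistribution
      (fun (N : ℕ) (ω : ℕ → X) =>
        √(N : ℝ) • ((est N fun i => ω i) - (ρ₀ : Matrix (Fin d) (Fin d) ℂ)))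
      atTop (tangentVector M ρ₀) (fun _ => E.sampleLaw ρ₀)
      (multivariateGaussian 0 (fisherMatrix E M ρ₀)⁻¹) ∧
    ∀ R ε : ℝ, 0 < ε →
      Tendsto (fun N : ℕ => E.sampleLaw ρ₀ {ω | ¬ ∀ ρ ∈ M,
          N * ((ρ - est N fun i => ω i) * (ρ - est N fun i => ω i)).trace.re ≤ R ^ 2 →
          (∀ i : Fin N, 0 < E.born ρ (ω i)) ∧
          |Real.log (E.likelihood (fun i : Fin N => ω i) ρ) -
              Real.log (E.likelihood (fun i : Fin N => ω i) (est N fun i => ω i)) +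
              N * E.fisherForm ρ₀ (ρ - est N fun i => ω i) (ρ - est N fun i => ω i) / 2| ≤ ε})
        atTop (𝓝 0)

/-- Metric-projected local asymptotic normality (MP-LAN): `M` is a convex subset of a model that
satisfies LAN. -/
def SatisfiesMPLAN (E : POVM d X) (M : Set (Matrix (Fin d) (Fin d) ℂ))
    (ρ₀ : quantumStates d) : Prop :=
  (ρ₀ : Matrix (Fin d) (Fin d) ℂ) ∈ M ∧ Convex ℝ M ∧ ∃ M', M ⊆ M' ∧ SatisfiesLAN E M' ρ₀

end LAN

attribute [local instance] Matrix.normedAddCommGroup Matrix.normedSpace in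
/-- The likelihood given the data `x` is twice continuously differentiable, as a function on the
real vector space of all complex `d × d` matrices (hence also along each affine subspace of it). -/
def LikelihoodIsC2 {d : ℕ} {X : Type*} [MeasurableSpace X] (E : POVM d X) {N : ℕ}
    (x : Fin N → X) : Prop :=
  ContDiff ℝ 2 (E.likelihood x)

end QuantumTomography

end

open MeasureTheory ProbabilityTheory Filter Topology
open scoped ENNReal ComplexOrder

/-! The model of trace-one Hermitian matrices is affine, so in tangent coordinates `θ` at the true
state the likelihood is, almost surely, a positive constant times `∏ (1 + ⟪S xᵢ, θ⟫)`, where the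
score is `S x = Tr(bⱼ Eₓ) / Tr(ρ₀ Eₓ)` for the tangent basis `b`. Finite Fisher information puts `S`
in `L²`; it is centred because the directions are traceless, and its covariance is the Fisher matrix
`I`, positive definite by nonsingularity. The rank of `ρ₀` plays no role: outcomes of zero density
are almost surely not observed, and finiteness of the information makes `Tr(h Eₓ)` vanish almost
everywhere on them.

With `v i = S xᵢ / √N` and `τ = √N θ`, everything follows from three facts: `∑ v i` is bounded in
probability (central limit theorem), `∑ v i ⊗ v i` is close to `I` (law of large numbers), and `max
‖v i‖` is small (an `L²` tail bound). `IsNearGaussian` records them as one event with parameters `B`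
and `δ`, where `δ` is chosen after `B`; the rest is deterministic.

On that event the Newton map with the fixed inverse Hessian `A = I⁻¹` contracts the ball of radius
`B` (`norm_newtonStep_sub_le`, `newtonLimit_spec`). Its fixed point is a critical point close to `A
∑ v i`, hence asymptotically Gaussian. The inequality `1 + u ≤ exp u` turns a critical point into
the unique maximizer (`prod_one_add_inner_le`), and a Taylor expansion there gives the quadratic
likelihood (`abs_log_expansion_le`). MP-LAN follows by convexity and inclusion of the state space.
-/

namespace QuantumTomography

/-! ### Deterministic analysis of products of affine functions. -/

section Deterministic

open scoped RealInnerProductSpace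

variable {F ι : Type*} [NormedAddCommGroup F] [InnerProductSpace ℝ F] [Fintype ι]

/-- The gradient of `τ ↦ ∑ i, log (1 + ⟪v i, τ⟫)`. -/
noncomputable def logGradient (v : ι → F) (τ : F) : F := ∑ i, (1 + ⟪v i, τ⟫)⁻¹ • v i

/-- One step of the simplified Newton iteration for a zero of `logGradient v`, with a fixed
approximation `A` of the inverse of the negative Hessian. -/
noncomputable def newtonStep (A : F →L[ℝ] F) (v : ι → F) (τ : F) : F := τ + A (logGradient v τ)

/-- The limit of the simplified Newton iteration started at the origin. -/
noncomputable def newtonLimit (A : F →L[ℝ] F) (v : ι → F) : F :=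
  limUnder atTop fun n : ℕ => (newtonStep A v)^[n] 0

/-- The data `v` are `δ`-close to having Gaussian log-likelihood with information `J = A⁻¹`,
with linear term bounded in terms of `B`. -/
structure IsNearGaussian (A J : F →L[ℝ] F) (v : ι → F) (B δ : ℝ) : Prop where
  score_le : 2 * ‖A (∑ i, v i)‖ ≤ B
  hessian_le : ∀ x, ‖J x - ∑ i, ⟪v i, x⟫ • v i‖ ≤ δ * ‖x‖
  norm_le : ∀ i, ‖v i‖ ≤ δ

/-- The denominator is at least `1/4` and the numerator `s + t + s t` at most `5η/2`, whence the
constant `10`. -/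
theorem abs_one_sub_inv_mul_le {s t η : ℝ} (hη : η ≤ 1 / 2) (hs : |s| ≤ η) (ht : |t| ≤ η) :
    |1 - ((1 + s) * (1 + t))⁻¹| ≤ 10 * η := by
  obtain ⟨hs1, hs2⟩ := abs_le.1 hs
  obtain ⟨ht1, ht2⟩ := abs_le.1 ht
  have h1 : 1 / 4 ≤ (1 + s) * (1 + t) := by nlinarith
  have hne : (1 + s) * (1 + t) ≠ 0 := by positivity
  have h2 : 1 - ((1 + s) * (1 + t))⁻¹ = (s + t + s * t) / ((1 + s) * (1 + t)) := by
    rw [eq_div_iff hne, sub_mul, inv_mul_cancel₀ hne]; ring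
  rw [h2, abs_div, abs_of_pos (by linarith : 0 < (1 + s) * (1 + t)),
    div_le_iff₀ (by linarith)]
  have h3 : |s * t| ≤ η * (1 / 2) := by
    rw [abs_mul]
    exact mul_le_mul hs (ht.trans hη) (abs_nonneg _) ((abs_nonneg _).trans hs)
  have h4 : |s + t + s * t| ≤ |s| + |t| + |s * t| := abs_add_three _ _ _
  nlinarith [abs_nonneg s]

theorem abs_log_one_add_sub_le {u : ℝ} (hu : |u| ≤ 1 / 2) :
    |Real.log (1 + u) - u + u ^ 2 / 2| ≤ 2 * |u| ^ 3 := by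
  have h := Real.abs_log_sub_add_sum_range_le (x := -u) (by rw [abs_neg]; linarith) 2
  rw [abs_neg] at h
  have h2 : |u| ^ 3 / (1 - |u|) ≤ 2 * |u| ^ 3 := by
    rw [div_le_iff₀ (by linarith)]
    nlinarith [pow_nonneg (abs_nonneg u) 3]
  refine le_trans (le_of_eq ?_) (h.trans h2)
  congr 1
  simp [Finset.sum_range_succ]
  ring

/-- Pair the sum `y` with itself, apply Cauchy–Schwarz over the index, and cancel one factor `‖y‖`.
The bound uses the quadratic form of the `v i` and not their number, so it is uniform in the sample
size. -/
theorem norm_sum_smul_le {v : ι → F} {c : ι → ℝ} {C K : ℝ} (hC : 0 ≤ C)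
    (hc : ∀ i, |c i| ≤ C) (hK : ∀ x, ∑ i, ⟪v i, x⟫ ^ 2 ≤ K * ‖x‖ ^ 2) (x : F) :
    ‖∑ i, (c i * ⟪v i, x⟫) • v i‖ ≤ C * K * ‖x‖ := by
  set y := ∑ i, (c i * ⟪v i, x⟫) • v i with hy
  have h1 : ‖y‖ ^ 2 = ∑ i, c i * (⟪v i, x⟫ * ⟪v i, y⟫) := by
    rw [← real_inner_self_eq_norm_sq]
    conv_lhs => rw [hy, sum_inner]
    exact Finset.sum_congr rfl fun i _ => by rw [real_inner_smul_left]; ring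
  have h2 : ∑ i, c i * (⟪v i, x⟫ * ⟪v i, y⟫) ≤ C * ∑ i, |⟪v i, x⟫| * |⟪v i, y⟫| := by
    rw [Finset.mul_sum]
    refine Finset.sum_le_sum fun i _ => (le_abs_self _).trans ?_
    rw [abs_mul, abs_mul]
    exact mul_le_mul_of_nonneg_right (hc i) (by positivity)
  have h3 : (∑ i, |⟪v i, x⟫| * |⟪v i, y⟫|) ^ 2 ≤ (K * ‖x‖ ^ 2) * (K * ‖y‖ ^ 2) := by
    refine (Finset.sum_mul_sq_le_sq_mul_sq _ _ _).trans ?_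
    simp only [sq_abs]
    exact mul_le_mul (hK x) (hK y) (Finset.sum_nonneg fun i _ => sq_nonneg _)
      ((Finset.sum_nonneg fun i _ => sq_nonneg _).trans (hK x))
  rcases eq_or_ne y 0 with h0 | h0
  · rw [h0, norm_zero]
    rcases eq_or_ne x 0 with hx | hx
    · simp [hx]
    · have : 0 ≤ K := by
        have := (Finset.sum_nonneg fun i _ => sq_nonneg _).trans (hK x)
        exact nonneg_of_mul_nonneg_left this (by positivity)
      positivity
  · have hKy : 0 ≤ K := by
      have := (Finset.sum_nonneg fun i _ => sq_nonneg _).trans (hK y)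
      exact nonneg_of_mul_nonneg_left this (by positivity)
    have h4 : ∑ i, |⟪v i, x⟫| * |⟪v i, y⟫| ≤ K * ‖x‖ * ‖y‖ := by
      refine abs_le_of_sq_le_sq' ?_ (by positivity) |>.2
      refine h3.trans (le_of_eq (by ring))
    have h5 : ‖y‖ * ‖y‖ ≤ (C * K * ‖x‖) * ‖y‖ := by
      nlinarith [mul_le_mul_of_nonneg_left h4 hC]
    exact le_of_mul_le_mul_right h5 (norm_pos_iff.2 h0)

namespace IsNearGaussian

variable {A J : F →L[ℝ] F} {v : ι → F} {B δ : ℝ}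

theorem abs_sum_sq_sub_le (h : IsNearGaussian A J v B δ) (x : F) :
    |∑ i, ⟪v i, x⟫ ^ 2 - ⟪x, J x⟫| ≤ δ * ‖x‖ ^ 2 := by
  have h1 : ∑ i, ⟪v i, x⟫ ^ 2 - ⟪x, J x⟫ = -⟪x, J x - ∑ i, ⟪v i, x⟫ • v i⟫ := by
    rw [inner_sub_right, inner_sum]
    simp only [real_inner_smul_right, real_inner_comm, sq]
    ring
  rw [h1, abs_neg]
  refine (abs_real_inner_le_norm _ _).trans ?_
  nlinarith [h.hessian_le x, norm_nonneg x]

theorem sum_sq_le (h : IsNearGaussian A J v B δ) (x : F) :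
    ∑ i, ⟪v i, x⟫ ^ 2 ≤ (‖J‖ + δ) * ‖x‖ ^ 2 := by
  have h1 := (abs_le.1 (h.abs_sum_sq_sub_le x)).2
  have h2 : ⟪x, J x⟫ ≤ ‖J‖ * ‖x‖ ^ 2 := by
    refine (real_inner_le_norm _ _).trans ?_
    nlinarith [J.le_opNorm x, norm_nonneg x]
  linarith

theorem abs_inner_le (h : IsNearGaussian A J v B δ) {τ : F} {b : ℝ} (hτ : ‖τ‖ ≤ b) (i : ι) :
    |⟪v i, τ⟫| ≤ δ * b :=
  (abs_real_inner_le_norm _ _).trans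
    (mul_le_mul (h.norm_le i) hτ (norm_nonneg _) ((norm_nonneg _).trans (h.norm_le i)))

/-- The identity `(1+s)⁻¹ - (1+t)⁻¹ = -(s-t) / ((1+s)(1+t))` splits the gradient difference into the
Hessian at the origin and a weighted correction. Since `A J = 1`, the identity part of the step
cancels that Hessian up to `δ`; the correction has weights of size `10 δ B`. -/
theorem norm_newtonStep_sub_le (h : IsNearGaussian A J v B δ) (hAJ : ∀ x, A (J x) = x)
    (hδ : 0 ≤ δ) (hδB : δ * B ≤ 1 / 2) {τ τ' : F} (hτ : ‖τ‖ ≤ B) (hτ' : ‖τ'‖ ≤ B) :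
    ‖newtonStep A v τ - newtonStep A v τ'‖ ≤
      ‖A‖ * (δ + 10 * (δ * B) * (‖J‖ + δ)) * ‖τ - τ'‖ := by
  set c : ι → ℝ := fun i => 1 - ((1 + ⟪v i, τ⟫) * (1 + ⟪v i, τ'⟫))⁻¹ with hc
  have hB : 0 ≤ B := (norm_nonneg _).trans hτ
  have key : newtonStep A v τ - newtonStep A v τ' =
      A ((J (τ - τ') - ∑ i, ⟪v i, τ - τ'⟫ • v i) + ∑ i, (c i * ⟪v i, τ - τ'⟫) • v i) := by
    have h1 : logGradient v τ - logGradient v τ' =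
        -(∑ i, ⟪v i, τ - τ'⟫ • v i) + ∑ i, (c i * ⟪v i, τ - τ'⟫) • v i := by
      rw [logGradient, logGradient, ← Finset.sum_sub_distrib, ← Finset.sum_neg_distrib,
        ← Finset.sum_add_distrib]
      refine Finset.sum_congr rfl fun i _ => ?_
      rw [← sub_smul, ← neg_smul, ← add_smul]
      congr 1
      have e1 := abs_le.1 (h.abs_inner_le hτ i)
      have e2 := abs_le.1 (h.abs_inner_le hτ' i)
      have p1 : (1 + ⟪v i, τ⟫) ≠ 0 := by linarith
      have p2 : (1 + ⟪v i, τ'⟫) ≠ 0 := by linarith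
      simp only [hc, inner_sub_right]
      field_simp
      ring
    rw [newtonStep, newtonStep, add_sub_add_comm, ← map_sub, h1, sub_eq_add_neg (J _), add_assoc,
      map_add A (J _), hAJ]
  have hcb : ∀ i, |c i| ≤ 10 * (δ * B) := fun i =>
    abs_one_sub_inv_mul_le hδB (h.abs_inner_le hτ i) (h.abs_inner_le hτ' i)
  rw [key, mul_assoc]
  refine (A.le_opNorm _).trans (mul_le_mul_of_nonneg_left ?_ (norm_nonneg _))
  rw [add_mul]
  exact (norm_add_le _ _).trans (add_le_add (h.hessian_le _)
    (norm_sum_smul_le (by positivity) hcb h.sum_sq_le _))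

/-- The simplified Newton iteration converges to a zero of the gradient. -/
theorem newtonLimit_spec [CompleteSpace F] (h : IsNearGaussian A J v B δ)
    (hAJ : ∀ x, A (J x) = x) (hJA : ∀ x, J (A x) = x) (hδ : 0 ≤ δ) (hδB : δ * B ≤ 1 / 2) {κ : ℝ}
    (hκ0 : 0 ≤ κ) (hκ : ‖A‖ * (δ + 10 * (δ * B) * (‖J‖ + δ)) ≤ κ) (hκ1 : κ ≤ 1 / 2) :
    ‖newtonLimit A v‖ ≤ B ∧ ‖newtonLimit A v - A (∑ i, v i)‖ ≤ κ * B ∧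
      logGradient v (newtonLimit A v) = 0 := by
  have hB : 0 ≤ B := le_trans (by positivity) h.score_le
  have hlip : ∀ τ τ' : F, ‖τ‖ ≤ B → ‖τ'‖ ≤ B →
      ‖newtonStep A v τ - newtonStep A v τ'‖ ≤ κ * ‖τ - τ'‖ := fun τ τ' h1 h2 =>
    (h.norm_newtonStep_sub_le hAJ hδ hδB h1 h2).trans
      (mul_le_mul_of_nonneg_right hκ (norm_nonneg _))
  have hT0 : newtonStep A v 0 = A (∑ i, v i) := by simp [newtonStep, logGradient]
  have hmaps : Set.MapsTo (newtonStep A v) (Metric.closedBall 0 B) (Metric.closedBall 0 B) := by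
    intro τ hτ
    rw [mem_closedBall_zero_iff] at hτ ⊢
    -- The first step has norm at most `B/2` by `score_le`, and `κ ≤ 1/2` leaves the other half of
    -- the radius for `κ ‖τ‖`.
    have h1 := hlip τ 0 hτ (by simpa using hB)
    rw [sub_zero, hT0] at h1
    have h2 := norm_le_insert' (newtonStep A v τ) (A (∑ i, v i))
    nlinarith [h.score_le, norm_nonneg τ]
  have hcontr : ContractingWith ⟨κ, hκ0⟩ (hmaps.restrict (newtonStep A v) _ _) := by
    refine ⟨NNReal.coe_lt_coe.1 (lt_of_le_of_lt hκ1 (by norm_num : (1 / 2 : ℝ) < 1)), ?_⟩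
    refine LipschitzWith.of_dist_le_mul fun τ τ' => ?_
    have h1 := hlip τ τ' (mem_closedBall_zero_iff.1 τ.2) (mem_closedBall_zero_iff.1 τ'.2)
    rw [← dist_eq_norm, ← dist_eq_norm] at h1
    exact h1
  obtain ⟨y, hyB, hfix, hlim, -⟩ := hcontr.exists_fixedPoint' Metric.isClosed_closedBall.isComplete
    hmaps (x := 0) (by simpa using hB) (edist_ne_top _ _)
  have hy : newtonLimit A v = y := hlim.limUnder_eq
  rw [mem_closedBall_zero_iff] at hyB
  rw [hy]
  refine ⟨hyB, ?_, ?_⟩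
  · have h1 := hlip y 0 hyB (by simpa using hB)
    rw [hfix.eq, hT0, sub_zero] at h1
    exact h1.trans (mul_le_mul_of_nonneg_left hyB hκ0)
  · have h1 : A (logGradient v y) = 0 := by
      have := hfix.eq
      rwa [newtonStep, add_eq_left] at this
    rw [← hJA (logGradient v y), h1, map_zero]

/-- The empirical Hessian is within `δ` of the invertible `J`, so for `‖A‖ δ < 1` it has trivial
kernel. This makes the maximizer unique. -/
theorem eq_zero_of_forall_inner_eq_zero (h : IsNearGaussian A J v B δ)
    (hAJ : ∀ x, A (J x) = x) (hδ : ‖A‖ * δ < 1) {x : F} (hx : ∀ i, ⟪v i, x⟫ = 0) : x = 0 := by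
  have h1 := h.hessian_le x
  simp only [hx, zero_smul, Finset.sum_const_zero, sub_zero] at h1
  have h2 : ‖x‖ ≤ ‖A‖ * δ * ‖x‖ := by
    calc ‖x‖ = ‖A (J x)‖ := by rw [hAJ]
      _ ≤ ‖A‖ * ‖J x‖ := A.le_opNorm _
      _ ≤ ‖A‖ * (δ * ‖x‖) := mul_le_mul_of_nonneg_left h1 (norm_nonneg _)
      _ = _ := by ring
  by_contra h0
  nlinarith [norm_pos_iff.2 h0]

/-- Second order expansion of the log-likelihood around a zero of its gradient. -/
theorem abs_log_expansion_le (h : IsNearGaussian A J v B δ) (hδ : 0 ≤ δ)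
    (hδB : δ * B ≤ 1 / 2) {R : ℝ}
    (hR : δ * R ≤ 1 / 8) {τ τ' : F} (hτ : ‖τ‖ ≤ B) (hgrad : logGradient v τ = 0)
    (hττ' : ‖τ' - τ‖ ≤ R) :
    (∀ i, 0 < 1 + ⟪v i, τ'⟫) ∧
      |∑ i, Real.log (1 + ⟪v i, τ'⟫) - ∑ i, Real.log (1 + ⟪v i, τ⟫) +
        ⟪τ' - τ, J (τ' - τ)⟫ / 2| ≤
      (16 * (δ * R) + 5 * (δ * B)) * ((‖J‖ + δ) * R ^ 2) + δ * R ^ 2 / 2 := by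
  have hR0 : 0 ≤ R := (norm_nonneg _).trans hττ'
  set x := τ' - τ with hx
  set t : ι → ℝ := fun i => ⟪v i, τ⟫ with ht
  set w : ι → ℝ := fun i => ⟪v i, x⟫ with hw
  -- Relative increments of the factors: `1 + ⟪v i, τ'⟫ = (1 + t i)(1 + u i)`, and criticality of
  -- `τ` says `∑ u i = 0`. The first-order term therefore drops out exactly.
  set u : ι → ℝ := fun i => (1 + t i)⁻¹ * w i with hu
  have htb : ∀ i, |t i| ≤ δ * B := fun i => h.abs_inner_le hτ i
  have hwb : ∀ i, |w i| ≤ δ * R := fun i => h.abs_inner_le hττ' i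
  have htpos : ∀ i, 1 / 2 ≤ 1 + t i := fun i => by linarith [(abs_le.1 (htb i)).1]
  have htinv : ∀ i, (1 + t i)⁻¹ ≤ 2 := fun i => by
    rw [inv_le_comm₀ (by linarith [htpos i]) two_pos]; linarith [htpos i]
  have hub : ∀ i, |u i| ≤ 2 * (δ * R) := fun i => by
    rw [hu, abs_mul, abs_inv, abs_of_pos (by linarith [htpos i] : 0 < 1 + t i)]
    exact mul_le_mul (htinv i) (hwb i) (abs_nonneg _) two_pos.le
  have hu2 : ∀ i, u i ^ 2 ≤ 4 * w i ^ 2 := fun i => by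
    have : (1 + t i)⁻¹ ^ 2 ≤ 4 := by
      have := htinv i
      have h0 : 0 ≤ (1 + t i)⁻¹ := inv_nonneg.2 (by linarith [htpos i])
      nlinarith
    rw [hu, mul_pow]
    exact mul_le_mul_of_nonneg_right this (sq_nonneg _)
  have hfac : ∀ i, 1 + ⟪v i, τ'⟫ = (1 + t i) * (1 + u i) := fun i => by
    have h0 : 1 + t i ≠ 0 := by linarith [htpos i]
    simp only [hu, hw, hx, ht, inner_sub_right] at h0 ⊢
    field_simp
    ring
  have hupos : ∀ i, 0 < 1 + u i := fun i => by linarith [(abs_le.1 (hub i)).1]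
  refine ⟨fun i => by rw [hfac]; exact mul_pos (by linarith [htpos i]) (hupos i), ?_⟩
  have hsum0 : ∑ i, u i = 0 := by
    have h1 : ⟪logGradient v τ, x⟫ = 0 := by rw [hgrad, inner_zero_left]
    rw [logGradient, sum_inner] at h1
    rw [← h1]
    exact Finset.sum_congr rfl fun i _ => by rw [real_inner_smul_left]
  have hlog : ∑ i, Real.log (1 + ⟪v i, τ'⟫) - ∑ i, Real.log (1 + ⟪v i, τ⟫) =
      ∑ i, (Real.log (1 + u i) - u i) := by
    rw [Finset.sum_sub_distrib, hsum0, sub_zero, ← Finset.sum_sub_distrib]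
    refine Finset.sum_congr rfl fun i _ => ?_
    rw [hfac, Real.log_mul (by linarith [htpos i]) (hupos i).ne']
    ring
  have hW : ∑ i, w i ^ 2 ≤ (‖J‖ + δ) * R ^ 2 := by
    refine (h.sum_sq_le x).trans ?_
    gcongr
  have e1 : |∑ i, (Real.log (1 + u i) - u i + u i ^ 2 / 2)| ≤
      16 * (δ * R) * ∑ i, w i ^ 2 := by
    rw [Finset.mul_sum]
    refine (Finset.abs_sum_le_sum_abs _ _).trans (Finset.sum_le_sum fun i _ => ?_)
    refine (abs_log_one_add_sub_le (by linarith [hub i])).trans ?_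
    calc 2 * |u i| ^ 3 = 2 * |u i| * u i ^ 2 := by rw [← sq_abs (u i)]; ring
      _ ≤ 2 * (2 * (δ * R)) * (4 * w i ^ 2) :=
        mul_le_mul (by linarith [hub i]) (hu2 i) (sq_nonneg _) (by positivity)
      _ = _ := by ring
  have e2 : |∑ i, (w i ^ 2 - u i ^ 2)| ≤ 10 * (δ * B) * ∑ i, w i ^ 2 := by
    rw [Finset.mul_sum]
    refine (Finset.abs_sum_le_sum_abs _ _).trans (Finset.sum_le_sum fun i _ => ?_)
    have : w i ^ 2 - u i ^ 2 = (1 - ((1 + t i) * (1 + t i))⁻¹) * w i ^ 2 := by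
      simp only [hu, mul_inv]; ring
    rw [this, abs_mul, abs_of_nonneg (sq_nonneg (w i))]
    exact mul_le_mul_of_nonneg_right (abs_one_sub_inv_mul_le hδB (htb i) (htb i)) (sq_nonneg _)
  have e3 : |∑ i, w i ^ 2 - ⟪x, J x⟫| ≤ δ * R ^ 2 :=
    (h.abs_sum_sq_sub_le x).trans (by gcongr)
  have hB0 : 0 ≤ B := (norm_nonneg _).trans hτ
  have e4 : (16 * (δ * R) + 5 * (δ * B)) * ∑ i, w i ^ 2 ≤
      (16 * (δ * R) + 5 * (δ * B)) * ((‖J‖ + δ) * R ^ 2) :=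
    mul_le_mul_of_nonneg_left hW (by positivity)
  -- Three errors: the cubic Taylor remainder, the replacement of `u i` by `w i`, and that of the
  -- empirical Hessian by `J`.
  have hdec : ∑ i, (Real.log (1 + u i) - u i) + ⟪x, J x⟫ / 2 =
      ∑ i, (Real.log (1 + u i) - u i + u i ^ 2 / 2) + (∑ i, (w i ^ 2 - u i ^ 2)) / 2 -
        (∑ i, w i ^ 2 - ⟪x, J x⟫) / 2 := by
    rw [Finset.sum_add_distrib, Finset.sum_sub_distrib (fun i => w i ^ 2), ← Finset.sum_div]
    ring
  rw [hlog, hdec]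
  rw [abs_le] at e1 e2 e3 ⊢
  constructor <;> linarith

end IsNearGaussian

/-- A critical point of `∑ i, log (1 + ⟪v i, τ⟫)` is the unique maximizer of
`∏ i, (1 + ⟪v i, τ⟫)` over the region where all factors are nonnegative. -/
theorem prod_one_add_inner_le {v : ι → F} {τ τ' : F} (hτ : ∀ i, 0 < 1 + ⟪v i, τ⟫)
    (hgrad : logGradient v τ = 0) (hτ' : ∀ i, 0 ≤ 1 + ⟪v i, τ'⟫) :
    ∏ i, (1 + ⟪v i, τ'⟫) ≤ ∏ i, (1 + ⟪v i, τ⟫) ∧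
      (∏ i, (1 + ⟪v i, τ'⟫) = ∏ i, (1 + ⟪v i, τ⟫) → ∀ i, ⟪v i, τ' - τ⟫ = 0) := by
  -- Criticality gives `∑ u i = 0`, so the numbers `exp (u i)` multiply to one while dominating the
  -- factor ratios `1 + u i`, strictly where `u i ≠ 0`. Vanishing factors at `τ'` do no harm.
  set u : ι → ℝ := fun i => (1 + ⟪v i, τ⟫)⁻¹ * ⟪v i, τ' - τ⟫ with hu
  have hfac : ∀ i, 1 + ⟪v i, τ'⟫ = (1 + ⟪v i, τ⟫) * (1 + u i) := fun i => by
    have h0 := (hτ i).ne'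
    simp only [hu, inner_sub_right]
    field_simp
    ring
  have hunn : ∀ i, 0 ≤ 1 + u i := fun i => by
    have := hτ' i
    rw [hfac] at this
    exact nonneg_of_mul_nonneg_right this (hτ i)
  have hsum0 : ∑ i, u i = 0 := by
    have h1 : ⟪logGradient v τ, τ' - τ⟫ = 0 := by rw [hgrad, inner_zero_left]
    rw [logGradient, sum_inner] at h1
    rw [← h1]
    exact Finset.sum_congr rfl fun i _ => by rw [real_inner_smul_left]
  have hexp : ∏ i, Real.exp (u i) = 1 := by rw [← Real.exp_sum, hsum0, Real.exp_zero]
  have hp : 0 < ∏ i, (1 + ⟪v i, τ⟫) := Finset.prod_pos fun i _ => hτ i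
  have hle : ∀ i, 1 + u i ≤ Real.exp (u i) := fun i => by
    linarith [Real.add_one_le_exp (u i)]
  simp only [hfac, Finset.prod_mul_distrib]
  constructor
  · refine mul_le_of_le_one_right hp.le ?_
    refine le_of_le_of_eq ?_ hexp
    exact Finset.prod_le_prod (fun i _ => hunn i) fun i _ => hle i
  · intro heq i
    rw [mul_eq_left₀ hp.ne'] at heq
    have hui : u i = 0 := by
      by_contra h0
      have : ∏ i, (1 + u i) < ∏ i, Real.exp (u i) := by
        refine Finset.prod_lt_prod (fun j _ => ?_) (fun j _ => hle j)
          ⟨i, Finset.mem_univ _, by linarith [Real.add_one_lt_exp h0]⟩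
        -- Strict comparison of products needs positive factors; one zero factor would contradict
        -- the product being `1`.
        refine lt_of_le_of_ne (hunn j) fun h => ?_
        rw [Finset.prod_eq_zero (Finset.mem_univ j) h.symm] at heq
        exact zero_ne_one heq
      linarith
    simpa [hu, (hτ i).ne'] using hui

end Deterministic

/-! ### Limit theorems for independent samples. -/

section Sampling

open scoped RealInnerProductSpace

variable {X : Type*} [MeasurableSpace X] {μ : Measure X}

/-- Markov's inequality on the tail bounds the quantity by the integral of `f` over `{f ≥ N}`, which
vanishes by dominated convergence. The gain from `O(1/N)` to `o(1/N)` is what a union bound over `N`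
samples needs. -/
theorem tendsto_natCast_mul_measure_ge {f : X → ℝ≥0∞} (hf : Measurable f)
    (hint : ∫⁻ x, f x ∂μ ≠ ∞) :
    Tendsto (fun N : ℕ => (N : ℝ≥0∞) * μ {x | (N : ℝ≥0∞) ≤ f x}) atTop (𝓝 0) := by
  have hms : ∀ N : ℕ, MeasurableSet {x | (N : ℝ≥0∞) ≤ f x} := fun N =>
    measurableSet_le measurable_const hf
  have hlim : Tendsto (fun N : ℕ => ∫⁻ x, {x | (N : ℝ≥0∞) ≤ f x}.indicator f x ∂μ) atTop
      (𝓝 (∫⁻ _, 0 ∂μ)) := by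
    refine tendsto_lintegral_of_dominated_convergence f (fun N => hf.indicator (hms N))
      (fun N => Eventually.of_forall fun x => Set.indicator_le_self _ _ _) hint ?_
    filter_upwards [ae_lt_top hf hint] with x hx
    refine tendsto_const_nhds.congr' ?_
    obtain ⟨n, hn⟩ := ENNReal.exists_nat_gt hx.ne
    filter_upwards [eventually_ge_atTop n] with N hN
    refine (Set.indicator_of_notMem ?_ _).symm
    simp only [Set.mem_ofPred_eq, not_le]
    exact hn.trans_le (by exact_mod_cast hN)
  rw [lintegral_zero] at hlim
  refine tendsto_of_tendsto_of_tendsto_of_le_of_le tendsto_const_nhds hlim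
    (fun _ => zero_le) fun N => ?_
  calc (N : ℝ≥0∞) * μ {x | (N : ℝ≥0∞) ≤ f x}
      = ∫⁻ x, {x | (N : ℝ≥0∞) ≤ f x}.indicator (fun _ => (N : ℝ≥0∞)) x ∂μ := by
        rw [lintegral_indicator_const (hms N)]
    _ ≤ _ := lintegral_mono fun x => by
        by_cases hx : (N : ℝ≥0∞) ≤ f x
        · simp [Set.indicator, hx]
        · simp [Set.indicator, hx]

variable [IsProbabilityMeasure μ] {F : Type*} [NormedAddCommGroup F] [MeasurableSpace F]
  [BorelSpace F]

theorem tendsto_measure_exists_norm_ge {S : X → F} (hS : Measurable S) (hS2 : MemLp S 2 μ)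
    {δ : ℝ} (hδ : 0 < δ) :
    Tendsto (fun N : ℕ => Measure.infinitePi (fun _ : ℕ => μ)
      {ω | ∃ i : Fin N, δ * √(N : ℝ) ≤ ‖S (ω i)‖}) atTop (𝓝 0) := by
  set f : X → ℝ≥0∞ := fun x => ENNReal.ofReal (‖S x‖ ^ 2 / δ ^ 2) with hf
  have hfm : Measurable f := by fun_prop
  have hint : ∫⁻ x, f x ∂μ ≠ ∞ := by
    have h1 : Integrable (fun x => ‖S x‖ ^ 2 / δ ^ 2) μ :=
      ((memLp_two_iff_integrable_sq_norm hS2.1).1 hS2).div_const _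
    exact h1.lintegral_lt_top.ne
  refine tendsto_of_tendsto_of_tendsto_of_le_of_le tendsto_const_nhds
    (tendsto_natCast_mul_measure_ge hfm hint) (fun _ => zero_le) fun N => ?_
  have hsub : {ω : ℕ → X | ∃ i : Fin N, δ * √(N : ℝ) ≤ ‖S (ω i)‖} ⊆
      ⋃ i : Fin N, (Function.eval (i : ℕ)) ⁻¹' {x | (N : ℝ≥0∞) ≤ f x} := by
    rintro ω ⟨i, hi⟩
    refine Set.mem_iUnion.2 ⟨i, ?_⟩
    simp only [Set.mem_preimage, Function.eval, Set.mem_ofPred_eq, hf]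
    rw [← ENNReal.ofReal_natCast]
    refine ENNReal.ofReal_le_ofReal ?_
    rw [le_div_iff₀ (by positivity)]
    calc (N : ℝ) * δ ^ 2 = (δ * √(N : ℝ)) ^ 2 := by
          rw [mul_pow, Real.sq_sqrt (Nat.cast_nonneg _)]; ring
      _ ≤ _ := by gcongr
  refine (measure_mono hsub).trans ((measure_iUnion_le _).trans ?_)
  rw [tsum_fintype]
  have hms : MeasurableSet {x | (N : ℝ≥0∞) ≤ f x} := measurableSet_le measurable_const hfm
  have : ∀ i : Fin N, Measure.infinitePi (fun _ : ℕ => μ)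
      ((Function.eval (i : ℕ)) ⁻¹' {x | (N : ℝ≥0∞) ≤ f x}) = μ {x | (N : ℝ≥0∞) ≤ f x} :=
    fun i => (measurePreserving_eval_infinitePi (fun _ : ℕ => μ) (i : ℕ)).measure_preimage
      hms.nullMeasurableSet
  rw [Finset.sum_congr (s₁ := Finset.univ) rfl fun i _ => this i]
  simp

theorem identDistrib_comp_eval {G : Type*} [MeasurableSpace G] {S : X → G} (hS : Measurable S)
    (i j : ℕ) :
    IdentDistrib (fun ω : ℕ → X => S (ω i)) (fun ω => S (ω j))
      (Measure.infinitePi fun _ : ℕ => μ) (Measure.infinitePi fun _ : ℕ => μ) := by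
  refine IdentDistrib.comp (u := S) (f := fun ω : ℕ → X => ω i) (g := fun ω : ℕ → X => ω j)
    ⟨(measurable_pi_apply i).aemeasurable, (measurable_pi_apply j).aemeasurable, ?_⟩ hS
  exact (measurePreserving_eval_infinitePi (fun _ : ℕ => μ) i).map_eq.trans
    (measurePreserving_eval_infinitePi (fun _ : ℕ => μ) j).map_eq.symm

theorem memLp_comp_eval {G : Type*} [NormedAddCommGroup G] {S : X → G} {p : ℝ≥0∞}
    (hS : MemLp S p μ) (i : ℕ) :
    MemLp (fun ω : ℕ → X => S (ω i)) p (Measure.infinitePi fun _ : ℕ => μ) :=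
  hS.comp_measurePreserving (measurePreserving_eval_infinitePi (fun _ : ℕ => μ) i)

theorem integral_comp_eval {G : Type*} [NormedAddCommGroup G] [NormedSpace ℝ G] {S : X → G}
    (hS : AEStronglyMeasurable S μ) (i : ℕ) :
    ∫ ω : ℕ → X, S (ω i) ∂(Measure.infinitePi fun _ : ℕ => μ) = ∫ x, S x ∂μ := by
  have h := (measurePreserving_eval_infinitePi (fun _ : ℕ => μ) i).map_eq
  conv_rhs => rw [← h]
  exact (integral_map (measurable_pi_apply i).aemeasurable (by rwa [h])).symm

variable [InnerProductSpace ℝ F] [FiniteDimensional ℝ F]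

/-- The empirical second moment operator converges in probability. -/
theorem tendsto_measure_empirical_hessian {S : X → F} (hS : Measurable S) (hS2 : MemLp S 2 μ)
    {J : F →L[ℝ] F} (hJ : ∀ x y, ⟪x, J y⟫ = ∫ z, ⟪S z, x⟫ * ⟪S z, y⟫ ∂μ) {δ : ℝ} (hδ : 0 < δ) :
    Tendsto (fun N : ℕ => Measure.infinitePi (fun _ : ℕ => μ)
      {ω | ¬ ∀ x, ‖J x - ∑ i : Fin N, ⟪(√(N : ℝ))⁻¹ • S (ω i), x⟫ • (√(N : ℝ))⁻¹ • S (ω i)‖ ≤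
        δ * ‖x‖}) atTop (𝓝 0) := by
  -- The norm of `T s` is `‖s‖²`, so square integrability of `S` suffices for the strong law in
  -- operator norm, which is uniform in `x`.
  set T : F → F →L[ℝ] F := fun s => InnerProductSpace.rankOne ℝ s s with hT
  have hTc : Continuous T := by
    simp only [hT]
    exact (InnerProductSpace.rankOne ℝ).continuous.clm_apply continuous_id
  have hTm : Measurable fun x => T (S x) := hTc.measurable.comp hS
  have hTi : Integrable (fun x => T (S x)) μ := by
    refine ((memLp_two_iff_integrable_sq_norm hS2.1).1 hS2).mono'
      hTm.aestronglyMeasurable (Eventually.of_forall fun x => ?_)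
    simp [hT, sq]
  have hTJ : ∫ x, T (S x) ∂μ = J := by
    ext y
    refine ext_inner_left ℝ fun x => ?_
    rw [ContinuousLinearMap.integral_apply hTi, hJ, ← integral_inner]
    · refine integral_congr_ae (Eventually.of_forall fun z => ?_)
      simp [hT, real_inner_smul_right, real_inner_comm, mul_comm]
    · exact hTi.apply_continuousLinearMap y
  have hslln := strong_law_ae (μ := Measure.infinitePi fun _ : ℕ => μ)
    (fun i (ω : ℕ → X) => T (S (ω i)))
    (memLp_one_iff_integrable.1 (memLp_comp_eval (memLp_one_iff_integrable.2 hTi) 0))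
    (fun i j hij => (iIndepFun_infinitePi (P := fun _ : ℕ => μ) (X := fun _ x => T (S x))
      fun _ => hTm).indepFun hij)
    (fun i => identDistrib_comp_eval hTm i 0)
  rw [integral_comp_eval hTm.aestronglyMeasurable, hTJ] at hslln
  have hprob := tendstoInMeasure_iff_norm.1 (tendstoInMeasure_of_tendsto_ae (fun N => by
    refine Measurable.aestronglyMeasurable (Measurable.fun_const_smul
      (Finset.measurable_fun_sum _ fun i _ => ?_) _)
    exact hTm.comp (measurable_pi_apply i)) hslln) δ hδ
  refine tendsto_of_tendsto_of_tendsto_of_le_of_le tendsto_const_nhds hprob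
    (fun _ => zero_le) fun N => measure_mono fun ω hω => ?_
  simp only [Set.mem_ofPred_eq] at hω ⊢
  by_contra hlt
  refine hω fun x => ?_
  have h1 : J x - ∑ i : Fin N, ⟪(√(N : ℝ))⁻¹ • S (ω i), x⟫ • (√(N : ℝ))⁻¹ • S (ω i) =
      -(((N : ℝ)⁻¹ • ∑ i ∈ Finset.range N, T (S (ω i)) - J) x) := by
    rw [Finset.sum_range fun i => T (S (ω i))]
    simp only [sub_apply, smul_apply,
      sum_apply, hT, InnerProductSpace.rankOne_apply, neg_sub,
      Finset.smul_sum]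
    congr 1
    refine Finset.sum_congr rfl fun i _ => ?_
    rw [real_inner_smul_left, smul_smul, smul_smul]
    congr 1
    have : (N : ℝ)⁻¹ = (√(N : ℝ))⁻¹ * (√(N : ℝ))⁻¹ := by
      rw [← mul_inv, Real.mul_self_sqrt (Nat.cast_nonneg _)]
    rw [this]; ring
  rw [h1, norm_neg]
  exact (ContinuousLinearMap.le_opNorm _ _).trans (by gcongr; exact (not_le.1 hlt).le)

/-- The multivariate central limit theorem. -/
theorem tendstoInDistribution_multivariateGaussian {m : ℕ} {W : X → EuclideanSpace ℝ (Fin m)}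
    (hW : Measurable W) (hW2 : MemLp W 2 μ) (hW0 : ∫ x, W x ∂μ = 0)
    {C : Matrix (Fin m) (Fin m) ℝ} (hC : C.PosSemidef)
    (hcov : ∀ t, ∫ x, ⟪W x, t⟫ ^ 2 ∂μ = t.ofLp ⬝ᵥ C.mulVec t.ofLp) :
    TendstoInDistribution
      (fun (N : ℕ) (ω : ℕ → X) => (√(N : ℝ))⁻¹ • ∑ i ∈ Finset.range N, W (ω i)) atTop id
      (fun _ => Measure.infinitePi fun _ : ℕ => μ) (multivariateGaussian 0 C) := by
  have hmeas : ∀ N : ℕ, Measurable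
      fun ω : ℕ → X => (√(N : ℝ))⁻¹ • ∑ i ∈ Finset.range N, W (ω i) := fun N =>
    Measurable.fun_const_smul (Finset.measurable_fun_sum _ fun i _ => hW.comp (measurable_pi_apply i)) _
  refine ⟨fun N => (hmeas N).aemeasurable, aemeasurable_id, ?_⟩
  refine ProbabilityMeasure.tendsto_iff_tendsto_charFun.2 fun t => ?_
  -- Cramér–Wold: the characteristic function of the vector sum at `t` is that of the real sum of
  -- the `w` at `1`, so the real central limit theorem suffices.
  set w : X → ℝ := fun x => ⟪W x, t⟫ with hw
  have hwm : Measurable w := by fun_prop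
  have hw2 : MemLp w 2 μ := hW2.inner_const t
  have hw0 : ∫ x, w x ∂μ = 0 := by
    have := integral_inner (𝕜 := ℝ) (hW2.integrable (by norm_num)) t
    simp only [hW0, inner_zero_right] at this
    rw [← this]
    exact integral_congr_ae (Eventually.of_forall fun x => real_inner_comm _ _)
  have hvar : Var[fun ω : ℕ → X => w (ω 0); Measure.infinitePi fun _ : ℕ => μ] =
      t.ofLp ⬝ᵥ C.mulVec t.ofLp := by
    have h := variance_eq_integral (X := fun ω : ℕ → X => w (ω 0))
      (μ := Measure.infinitePi fun _ : ℕ => μ) (hwm.comp (measurable_pi_apply 0)).aemeasurable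
    rw [h, integral_comp_eval hwm.aestronglyMeasurable, hw0, ← hcov]
    simp only [sub_zero]
    exact integral_comp_eval (S := fun x => w x ^ 2) (by fun_prop) 0
  have hclt := tendstoInDistribution_inv_sqrt_mul_sum_sub
    (P := Measure.infinitePi fun _ : ℕ => μ) (X := fun i (ω : ℕ → X) => w (ω i)) (Y := id)
    (HasLaw.id) (memLp_comp_eval hw2 0)
    (iIndepFun_infinitePi (P := fun _ : ℕ => μ) (X := fun _ x => w x) fun _ => hwm)
    (fun i => identDistrib_comp_eval hwm i 0)
  rw [integral_comp_eval hwm.aestronglyMeasurable, hw0] at hclt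
  have hlim := ProbabilityMeasure.tendsto_iff_tendsto_charFun.1 hclt.tendsto 1
  simp only [ProbabilityMeasure.coe_mk, Measure.map_id, charFun_gaussianReal,
    charFun_multivariateGaussian hC] at hlim ⊢
  rw [hvar] at hlim
  have hnn : 0 ≤ t.ofLp ⬝ᵥ C.mulVec t.ofLp := by
    rw [← hcov]; exact integral_nonneg fun x => sq_nonneg _
  rw [Real.coe_toNNReal _ hnn] at hlim
  refine (hlim.congr fun N => ?_).trans (le_of_eq ?_)
  · rw [charFun_apply_real, charFun_apply, integral_map (hclt.forall_aemeasurable N) (by fun_prop),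
      integral_map (hmeas N).aemeasurable (by fun_prop)]
    refine integral_congr_ae (Eventually.of_forall fun ω => ?_)
    simp [hw, real_inner_smul_left, sum_inner]
  · simp

end Sampling

/-! ### Asymptotics of the linear model with density ratio `1 + ⟪S, θ⟫`. -/

section LinearModel

open scoped RealInnerProductSpace

variable {X : Type*} {m : ℕ}

/-- The observed scores, in the local scale `1 / √N`. -/
noncomputable def scaledScore (S : X → EuclideanSpace ℝ (Fin m)) {N : ℕ} (x : Fin N → X)
    (i : Fin N) : EuclideanSpace ℝ (Fin m) :=
  (√(N : ℝ))⁻¹ • S (x i)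

/-- The maximum likelihood estimator for the family of densities `1 + ⟪S, θ⟫` with Fisher
information matrix `I` at `θ = 0`, as a limit of simplified Newton iterations. -/
noncomputable def newtonMLE (I : Matrix (Fin m) (Fin m) ℝ) (S : X → EuclideanSpace ℝ (Fin m))
    (N : ℕ) (x : Fin N → X) : EuclideanSpace ℝ (Fin m) :=
  (√(N : ℝ))⁻¹ • newtonLimit (Matrix.toEuclideanCLM (𝕜 := ℝ) I⁻¹) (scaledScore S x)

variable {I : Matrix (Fin m) (Fin m) ℝ} {S : X → EuclideanSpace ℝ (Fin m)}

theorem inner_scaledScore {N : ℕ} (hN : 0 < N) (x : Fin N → X) (i : Fin N)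
    (θ : EuclideanSpace ℝ (Fin m)) :
    ⟪scaledScore S x i, √(N : ℝ) • θ⟫ = ⟪S (x i), θ⟫ := by
  have : √(N : ℝ) ≠ 0 := (Real.sqrt_pos.2 (Nat.cast_pos.2 hN)).ne'
  rw [scaledScore, real_inner_smul_left, real_inner_smul_right, inv_mul_cancel_left₀ this]

theorem sqrt_smul_newtonMLE {N : ℕ} (hN : 0 < N) (x : Fin N → X) :
    √(N : ℝ) • newtonMLE I S N x =
      newtonLimit (Matrix.toEuclideanCLM (𝕜 := ℝ) I⁻¹) (scaledScore S x) := by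
  rw [newtonMLE, smul_inv_smul₀ (Real.sqrt_pos.2 (Nat.cast_pos.2 hN)).ne']

theorem logGradient_scaledScore {N : ℕ} (hN : 0 < N) (x : Fin N → X)
    (θ : EuclideanSpace ℝ (Fin m)) :
    logGradient (scaledScore S x) (√(N : ℝ) • θ) =
      (√(N : ℝ))⁻¹ • logGradient (fun i => S (x i)) θ := by
  simp only [logGradient, inner_scaledScore hN, Finset.smul_sum]
  exact Finset.sum_congr rfl fun i _ => by rw [scaledScore, smul_comm]

variable [MeasurableSpace X] {μ : Measure X}

/-- Each iterate depends measurably on the data, and `limUnder` preserves measurability even where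
the iteration diverges. Defining the estimator as such a limit avoids a measurable selection of
maximizers. -/
theorem measurable_newtonMLE (hS : Measurable S) (N : ℕ) : Measurable (newtonMLE I S N) := by
  have hs : ∀ i : Fin N, Measurable fun x : Fin N → X => scaledScore S x i := fun i =>
    Measurable.fun_const_smul (hS.comp (measurable_pi_apply i)) _
  have hiter : ∀ n : ℕ, Measurable fun x : Fin N → X =>
      (newtonStep (Matrix.toEuclideanCLM (𝕜 := ℝ) I⁻¹) (scaledScore S x))^[n] 0 := by
    intro n
    induction n with
    | zero => exact measurable_const
    | succ n ih =>
      simp only [Function.iterate_succ', Function.comp_apply]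
      refine ih.add ((ContinuousLinearMap.measurable _).comp
        (Finset.measurable_fun_sum _ fun i _ => ?_))
      exact (measurable_const.add ((hs i).inner (𝕜 := ℝ) ih)).inv.smul (hs i)
  exact Measurable.fun_const_smul
    (StronglyMeasurable.limUnder fun n => (hiter n).stronglyMeasurable).measurable _

theorem toEuclideanCLM_inv_apply (hI : IsUnit I.det) (x : EuclideanSpace ℝ (Fin m)) :
    Matrix.toEuclideanCLM (𝕜 := ℝ) I⁻¹ (Matrix.toEuclideanCLM (𝕜 := ℝ) I x) = x := by
  rw [← mul_apply_eq_comp, ← map_mul, Matrix.nonsing_inv_mul _ hI, map_one]; rfl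

theorem toEuclideanCLM_apply_inv (hI : IsUnit I.det) (x : EuclideanSpace ℝ (Fin m)) :
    Matrix.toEuclideanCLM (𝕜 := ℝ) I (Matrix.toEuclideanCLM (𝕜 := ℝ) I⁻¹ x) = x := by
  rw [← mul_apply_eq_comp, ← map_mul, Matrix.mul_nonsing_inv _ hI, map_one]; rfl

theorem inner_toEuclideanCLM_inv (hI : I.PosDef) (x y : EuclideanSpace ℝ (Fin m)) :
    ⟪Matrix.toEuclideanCLM (𝕜 := ℝ) I⁻¹ x, y⟫ = ⟪x, Matrix.toEuclideanCLM (𝕜 := ℝ) I⁻¹ y⟫ := by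
  have h : IsSelfAdjoint (Matrix.toEuclideanCLM (𝕜 := ℝ) I⁻¹) :=
    IsSelfAdjoint.map (show IsSelfAdjoint I⁻¹ from hI.inv.isHermitian) _
  rw [← ContinuousLinearMap.adjoint_inner_left, h.adjoint_eq]

theorem exists_measure_norm_ge_lt {F : Type*} [NormedAddCommGroup F] [MeasurableSpace F]
    [BorelSpace F] (γ : Measure F) [IsFiniteMeasure γ] {ε : ℝ≥0∞} (hε : 0 < ε) :
    ∃ b : ℝ, 0 < b ∧ γ {z | b ≤ ‖z‖} < ε := by
  have h := tendsto_measure_iInter_atTop (μ := γ) (s := fun n : ℕ => {z : F | (n : ℝ) ≤ ‖z‖})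
    (fun n => (measurableSet_le measurable_const measurable_norm).nullMeasurableSet)
    (fun n k hnk z hz => le_trans (Nat.cast_le.2 hnk : (n : ℝ) ≤ k) hz) ⟨0, measure_ne_top _ _⟩
  have hempty : ⋂ n : ℕ, {z : F | (n : ℝ) ≤ ‖z‖} = ∅ := by
    refine Set.eq_empty_of_forall_notMem fun z hz => ?_
    obtain ⟨n, hn⟩ := exists_nat_gt ‖z‖
    exact absurd (Set.mem_iInter.1 hz n) (not_le.2 hn)
  rw [hempty, measure_empty] at h
  obtain ⟨n, hn, hn0⟩ := ((h.eventually (gt_mem_nhds hε)).and (eventually_gt_atTop 0)).exists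
  exact ⟨n, Nat.cast_pos.2 hn0, hn⟩

variable [IsProbabilityMeasure μ]

theorem tendstoInDistribution_score (hS : Measurable S) (hS2 : MemLp S 2 μ)
    (hS0 : ∫ x, S x ∂μ = 0) (hI : I.PosDef)
    (hcov : ∀ x y, ⟪x, Matrix.toEuclideanCLM (𝕜 := ℝ) I y⟫ = ∫ z, ⟪S z, x⟫ * ⟪S z, y⟫ ∂μ) :
    TendstoInDistribution
      (fun (N : ℕ) (ω : ℕ → X) => Matrix.toEuclideanCLM (𝕜 := ℝ) I⁻¹
        (∑ i, scaledScore S (fun i : Fin N => ω i) i)) atTop id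
      (fun _ => Measure.infinitePi fun _ : ℕ => μ) (multivariateGaussian 0 I⁻¹) := by
  set A := Matrix.toEuclideanCLM (𝕜 := ℝ) I⁻¹ with hA
  have h := tendstoInDistribution_multivariateGaussian (μ := μ) (W := fun x => A (S x))
    (A.measurable.comp hS) (A.comp_memLp' hS2)
    (by rw [A.integral_comp_comm (hS2.integrable (by norm_num)), hS0, map_zero])
    hI.inv.posSemidef (fun t => by
      -- The covariance of `A S` is `A I A = A`, because `A = I⁻¹` is self-adjoint.
      rw [← Matrix.inner_toEuclideanCLM, ← hA]
      have h1 := hcov (A t) (A t)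
      rw [toEuclideanCLM_apply_inv ((Matrix.isUnit_iff_isUnit_det _).1 hI.isUnit),
        real_inner_comm] at h1
      rw [h1]
      refine integral_congr_ae (Eventually.of_forall fun z => ?_)
      simp only [sq]
      rw [inner_toEuclideanCLM_inv hI])
  refine h.congr (fun N => Eventually.of_forall fun ω => ?_) .rfl
  simp only [scaledScore]
  rw [← Finset.smul_sum, map_smul, map_sum, Finset.sum_range fun i => A (S (ω i))]

/-- Each of the three conditions fails with probability below `ε / 3`. Only the score bound fixes
`B`, through the Gaussian limit and the portmanteau theorem for a closed set; so `δ` may be chosen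
afterwards, depending on `B`. -/
theorem exists_eventually_isNearGaussian (hS : Measurable S) (hS2 : MemLp S 2 μ)
    (hS0 : ∫ x, S x ∂μ = 0) (hI : I.PosDef)
    (hcov : ∀ x y, ⟪x, Matrix.toEuclideanCLM (𝕜 := ℝ) I y⟫ = ∫ z, ⟪S z, x⟫ * ⟪S z, y⟫ ∂μ)
    {ε : ℝ≥0∞} (hε : 0 < ε) :
    ∃ B : ℝ, 0 < B ∧ ∀ δ : ℝ, 0 < δ → ∀ᶠ N : ℕ in atTop,
      Measure.infinitePi (fun _ : ℕ => μ) {ω | ¬ IsNearGaussian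
        (Matrix.toEuclideanCLM (𝕜 := ℝ) I⁻¹) (Matrix.toEuclideanCLM (𝕜 := ℝ) I)
        (scaledScore S fun i : Fin N => ω i) B δ} ≤ ε := by
  have hε3 : 0 < ε / 3 := ENNReal.div_pos hε.ne' (by norm_num)
  obtain ⟨b, hb, hγ⟩ := exists_measure_norm_ge_lt (multivariateGaussian 0 I⁻¹) hε3
  refine ⟨2 * b, by positivity, fun δ hδ => ?_⟩
  have hclt := tendstoInDistribution_score hS hS2 hS0 hI hcov
  have hclosed : IsClosed {z : EuclideanSpace ℝ (Fin m) | b ≤ ‖z‖} :=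
    isClosed_le continuous_const continuous_norm
  have hport := ProbabilityMeasure.limsup_measure_closed_le_of_tendsto hclt.tendsto hclosed
  simp only [ProbabilityMeasure.coe_mk, Measure.map_id] at hport
  have h1 := eventually_lt_of_limsup_lt (hport.trans_lt hγ)
  have h2 := (tendsto_measure_empirical_hessian hS hS2 hcov hδ).eventually (gt_mem_nhds hε3)
  have h3 := (tendsto_measure_exists_norm_ge hS hS2 hδ).eventually (gt_mem_nhds hε3)
  filter_upwards [h1, h2, h3] with N h1 h2 h3
  rw [Measure.map_apply_of_aemeasurable (hclt.forall_aemeasurable N) hclosed.measurableSet] at h1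
  have hsum : ε / 3 + ε / 3 + ε / 3 = ε := ENNReal.add_thirds ε
  rw [← hsum]
  refine (measure_mono ?_).trans ((measure_union_le _ _).trans (add_le_add
    ((measure_union_le _ _).trans (add_le_add h1.le h2.le)) h3.le))
  intro ω hω
  by_contra hcon
  simp only [Set.mem_union, not_or, Set.mem_preimage, Set.mem_ofPred_eq, not_not, not_exists,
    not_le] at hcon
  obtain ⟨⟨c1, c2⟩, c3⟩ := hcon
  refine hω ⟨by linarith, c2, fun i => ?_⟩
  have hN : 0 < √(N : ℝ) := Real.sqrt_pos.2 (Nat.cast_pos.2 i.pos)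
  rw [scaledScore, norm_smul, norm_inv, Real.norm_of_nonneg hN.le, inv_mul_le_iff₀ hN, mul_comm]
  exact (c3 i).le

/-- An event has vanishing probability if it does not occur for nearly Gaussian data. -/
theorem tendsto_measure_of_isNearGaussian (hS : Measurable S) (hS2 : MemLp S 2 μ)
    (hS0 : ∫ x, S x ∂μ = 0) (hI : I.PosDef)
    (hcov : ∀ x y, ⟪x, Matrix.toEuclideanCLM (𝕜 := ℝ) I y⟫ = ∫ z, ⟪S z, x⟫ * ⟪S z, y⟫ ∂μ)
    {bad : ℕ → Set (ℕ → X)}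
    (hbad : ∀ B : ℝ, 0 < B → ∃ δ : ℝ, 0 < δ ∧ ∀ N : ℕ, 0 < N → ∀ ω ∈ bad N, ¬ IsNearGaussian
        (Matrix.toEuclideanCLM (𝕜 := ℝ) I⁻¹) (Matrix.toEuclideanCLM (𝕜 := ℝ) I)
        (scaledScore S fun i : Fin N => ω i) B δ) :
    Tendsto (fun N => Measure.infinitePi (fun _ : ℕ => μ) (bad N)) atTop (𝓝 0) := by
  rw [ENNReal.tendsto_nhds_zero]
  intro ε hε
  obtain ⟨B, hB, h⟩ := exists_eventually_isNearGaussian hS hS2 hS0 hI hcov hε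
  obtain ⟨δ, hδ, hδbad⟩ := hbad B hB
  filter_upwards [h δ hδ, eventually_gt_atTop 0] with N hN hN0
  exact (measure_mono fun ω hω => hδbad N hN0 ω hω).trans hN

/-- Every left-hand side is continuous in `δ` and vanishes at `δ = 0`. -/
theorem exists_tolerance {a j B R κ ε : ℝ} (hκ : 0 < κ) (hε : 0 < ε) :
    ∃ δ : ℝ, 0 < δ ∧ δ * B ≤ 1 / 2 ∧ a * (δ + 10 * (δ * B) * (j + δ)) ≤ κ ∧ a * δ < 1 ∧
      δ * R ≤ 1 / 8 ∧
      (16 * (δ * R) + 5 * (δ * B)) * ((j + δ) * R ^ 2) + δ * R ^ 2 / 2 ≤ ε := by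
  have key : ∀ (f : ℝ → ℝ) (c : ℝ), Continuous f → f 0 = 0 → 0 < c →
      ∀ᶠ δ in 𝓝[>] (0 : ℝ), f δ < c := fun f c hf h0 hc =>
    (((hf.tendsto' 0 0 h0).eventually (gt_mem_nhds hc))).filter_mono nhdsWithin_le_nhds
  obtain ⟨δ, h0, h1, h2, h3, h4, h5⟩ := ((eventually_mem_nhdsWithin (a := (0 : ℝ))
      (s := Set.Ioi 0)).and <|
    (key (fun δ => δ * B) (1 / 2) (by fun_prop) (by simp) (by norm_num)).and <|
    (key (fun δ => a * (δ + 10 * (δ * B) * (j + δ))) κ (by fun_prop) (by simp) hκ).and <|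
    (key (fun δ => a * δ) 1 (by fun_prop) (by simp) one_pos).and <|
    (key (fun δ => δ * R) (1 / 8) (by fun_prop) (by simp) (by norm_num)).and <|
    key (fun δ => (16 * (δ * R) + 5 * (δ * B)) * ((j + δ) * R ^ 2) + δ * R ^ 2 / 2) ε
      (by fun_prop) (by simp) hε).exists
  exact ⟨δ, h0, h1.le, h2.le, h3, h4.le, h5.le⟩

/-- With probability tending to one, `newtonMLE` is an interior critical point of the
likelihood, and the observed scores separate directions. -/
theorem tendsto_measure_not_critical (hS : Measurable S) (hS2 : MemLp S 2 μ)
    (hS0 : ∫ x, S x ∂μ = 0) (hI : I.PosDef)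
    (hcov : ∀ x y, ⟪x, Matrix.toEuclideanCLM (𝕜 := ℝ) I y⟫ = ∫ z, ⟪S z, x⟫ * ⟪S z, y⟫ ∂μ) :
    Tendsto (fun N : ℕ => Measure.infinitePi (fun _ : ℕ => μ) {ω |
      ¬ ((∀ i : Fin N, 0 < 1 + ⟪S (ω i), newtonMLE I S N fun i => ω i⟫) ∧
        logGradient (fun i : Fin N => S (ω i)) (newtonMLE I S N fun i => ω i) = 0 ∧
        ∀ θ, (∀ i : Fin N, ⟪S (ω i), θ⟫ = 0) → θ = 0)}) atTop (𝓝 0) := by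
  refine tendsto_measure_of_isNearGaussian hS hS2 hS0 hI hcov fun B hB => ?_
  have hdet := (Matrix.isUnit_iff_isUnit_det _).1 hI.isUnit
  obtain ⟨δ, h0, h1, h2, h3, -, -⟩ := exists_tolerance
    (a := ‖Matrix.toEuclideanCLM (𝕜 := ℝ) I⁻¹‖) (j := ‖Matrix.toEuclideanCLM (𝕜 := ℝ) I‖) (B := B)
    (R := 0) (κ := 1 / 2) (ε := 1) (by norm_num) one_pos
  refine ⟨δ, h0, fun N hN ω hω hng => hω ?_⟩
  obtain ⟨e1, -, e3⟩ := hng.newtonLimit_spec (toEuclideanCLM_inv_apply hdet)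
    (toEuclideanCLM_apply_inv hdet) h0.le h1 (by norm_num) h2 le_rfl
  rw [← sqrt_smul_newtonMLE hN] at e1 e3
  refine ⟨fun i => ?_, ?_, fun θ hθ => ?_⟩
  · have := hng.abs_inner_le e1 i
    rw [inner_scaledScore hN, abs_le] at this
    linarith
  · rw [logGradient_scaledScore hN] at e3
    exact (smul_eq_zero.1 e3).resolve_left
      (inv_ne_zero (Real.sqrt_pos.2 (Nat.cast_pos.2 hN)).ne')
  · refine hng.eq_zero_of_forall_inner_eq_zero (toEuclideanCLM_inv_apply hdet) h3 fun i => ?_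
    rw [scaledScore, real_inner_smul_left, hθ i, mul_zero]

/-- Asymptotic normality of the maximum likelihood estimator. -/
theorem tendstoInDistribution_newtonMLE (hS : Measurable S) (hS2 : MemLp S 2 μ)
    (hS0 : ∫ x, S x ∂μ = 0) (hI : I.PosDef)
    (hcov : ∀ x y, ⟪x, Matrix.toEuclideanCLM (𝕜 := ℝ) I y⟫ = ∫ z, ⟪S z, x⟫ * ⟪S z, y⟫ ∂μ) :
    TendstoInDistribution
      (fun (N : ℕ) (ω : ℕ → X) => √(N : ℝ) • newtonMLE I S N fun i => ω i) atTop id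
      (fun _ => Measure.infinitePi fun _ : ℕ => μ) (multivariateGaussian 0 I⁻¹) := by
  have hdet := (Matrix.isUnit_iff_isUnit_det _).1 hI.isUnit
  -- Slutsky: the estimator differs from the linear statistic `A ∑ v i` by at most `κ B`. The choice
  -- of `κ` below makes this at most `ε / 2`, strictly less than `ε`.
  refine tendstoInDistribution_of_tendstoInMeasure_sub _ _
    (tendstoInDistribution_score hS hS2 hS0 hI hcov) ?_ fun N => ?_
  · rw [tendstoInMeasure_iff_norm]
    intro ε hε
    refine tendsto_measure_of_isNearGaussian hS hS2 hS0 hI hcov fun B hB => ?_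
    obtain ⟨δ, h0, h1, h2, -⟩ := exists_tolerance
      (a := ‖Matrix.toEuclideanCLM (𝕜 := ℝ) I⁻¹‖) (j := ‖Matrix.toEuclideanCLM (𝕜 := ℝ) I‖)
      (B := B) (R := 0) (κ := min (1 / 2) (ε / (2 * B))) (ε := 1) (by positivity) one_pos
    refine ⟨δ, h0, fun N hN ω hω hng => ?_⟩
    obtain ⟨-, e2, -⟩ := hng.newtonLimit_spec (toEuclideanCLM_inv_apply hdet)
      (toEuclideanCLM_apply_inv hdet) h0.le h1 (by positivity) h2 (min_le_left _ _)
    rw [← sqrt_smul_newtonMLE hN] at e2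
    have e4 : min (1 / 2) (ε / (2 * B)) * B ≤ ε / 2 := by
      refine (mul_le_mul_of_nonneg_right (min_le_right _ _) hB.le).trans (le_of_eq ?_)
      field_simp
    simp only [Set.mem_ofPred_eq, Pi.sub_apply, Pi.zero_apply, sub_zero] at hω
    linarith
  · exact (Measurable.fun_const_smul ((measurable_newtonMLE hS N).comp
      (measurable_pi_lambda _ fun i => measurable_pi_apply _)) _).aemeasurable

/-- With probability tending to one, the log-likelihood is quadratic near its maximizer. -/
theorem tendsto_measure_not_quadratic (hS : Measurable S) (hS2 : MemLp S 2 μ)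
    (hS0 : ∫ x, S x ∂μ = 0) (hI : I.PosDef)
    (hcov : ∀ x y, ⟪x, Matrix.toEuclideanCLM (𝕜 := ℝ) I y⟫ = ∫ z, ⟪S z, x⟫ * ⟪S z, y⟫ ∂μ)
    {R ε : ℝ} (hε : 0 < ε) :
    Tendsto (fun N : ℕ => Measure.infinitePi (fun _ : ℕ => μ) {ω |
      ¬ ∀ θ, √(N : ℝ) * ‖θ - newtonMLE I S N fun i => ω i‖ ≤ R →
        (∀ i : Fin N, 0 < 1 + ⟪S (ω i), θ⟫) ∧
        |∑ i : Fin N, Real.log (1 + ⟪S (ω i), θ⟫) -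
            ∑ i : Fin N, Real.log (1 + ⟪S (ω i), newtonMLE I S N fun i => ω i⟫) +
          N * ⟪θ - newtonMLE I S N fun i => ω i, Matrix.toEuclideanCLM (𝕜 := ℝ) I
            (θ - newtonMLE I S N fun i => ω i)⟫ / 2| ≤ ε}) atTop (𝓝 0) := by
  refine tendsto_measure_of_isNearGaussian hS hS2 hS0 hI hcov fun B hB => ?_
  have hdet := (Matrix.isUnit_iff_isUnit_det _).1 hI.isUnit
  obtain ⟨δ, h0, h1, h2, -, h4, h5⟩ := exists_tolerance
    (a := ‖Matrix.toEuclideanCLM (𝕜 := ℝ) I⁻¹‖) (j := ‖Matrix.toEuclideanCLM (𝕜 := ℝ) I‖) (B := B)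
    (R := R) (κ := 1 / 2) (ε := ε) (by norm_num) hε
  refine ⟨δ, h0, fun N hN ω hω hng => hω fun θ hθ => ?_⟩
  obtain ⟨e1, -, e3⟩ := hng.newtonLimit_spec (toEuclideanCLM_inv_apply hdet)
    (toEuclideanCLM_apply_inv hdet) h0.le h1 (by norm_num) h2 le_rfl
  rw [← sqrt_smul_newtonMLE hN] at e1 e3
  obtain ⟨f1, f2⟩ := hng.abs_log_expansion_le h0.le h1 h4 e1 e3 (τ' := √(N : ℝ) • θ) (by
    rwa [← smul_sub, norm_smul, Real.norm_of_nonneg (Real.sqrt_nonneg _)])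
  simp only [inner_scaledScore hN] at f1 f2
  refine ⟨f1, le_trans (le_of_eq ?_) (f2.trans h5)⟩
  rw [← smul_sub, map_smul, real_inner_smul_left, real_inner_smul_right, ← mul_assoc,
    Real.mul_self_sqrt (Nat.cast_nonneg _)]

end LinearModel

/-! ### The affine geometry of the trace-one Hermitian model. -/

section Geometry

variable {d : ℕ}

theorem convex_quantumStates : Convex ℝ (quantumStates d) := by
  intro ρ hρ σ hσ a b ha hb hab
  refine ⟨(hρ.1.smul ha).add (hσ.1.smul hb), ?_⟩
  rw [Matrix.trace_add, Matrix.trace_smul, Matrix.trace_smul, hρ.2, hσ.2, ← add_smul, hab, one_smul]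

theorem quantumStates_subset_traceOneHermitian : quantumStates d ⊆ traceOneHermitian d :=
  fun _ hρ => ⟨hρ.1.isHermitian, hρ.2⟩

/-- The real vector space of traceless Hermitian matrices. -/
def tracelessHermitian (d : ℕ) : Submodule ℝ (Matrix (Fin d) (Fin d) ℂ) where
  carrier := {h | h.IsHermitian ∧ h.trace = 0}
  zero_mem' := ⟨Matrix.isHermitian_zero, Matrix.trace_zero _ _⟩
  add_mem' := fun ha hb => ⟨ha.1.add hb.1, by rw [Matrix.trace_add, ha.2, hb.2, add_zero]⟩
  smul_mem' := fun c h hh => ⟨by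
    rw [Matrix.IsHermitian, Matrix.conjTranspose_smul, star_trivial, hh.1.eq],
    by rw [Matrix.trace_smul, hh.2, smul_zero]⟩

theorem isClosed_tracelessHermitian :
    IsClosed (tracelessHermitian d : Set (Matrix (Fin d) (Fin d) ℂ)) := by
  refine IsClosed.inter (s₁ := {h : Matrix (Fin d) (Fin d) ℂ | h.IsHermitian})
    (s₂ := {h : Matrix (Fin d) (Fin d) ℂ | h.trace = 0}) ?_ ?_
  · exact isClosed_eq (by fun_prop) continuous_id
  · exact isClosed_eq (by fun_prop) continuous_const

theorem add_mem_traceOneHermitian_iff {ρ h : Matrix (Fin d) (Fin d) ℂ}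
    (hρ : ρ ∈ traceOneHermitian d) : ρ + h ∈ traceOneHermitian d ↔ h ∈ tracelessHermitian d := by
  constructor
  · intro hh
    refine ⟨?_, ?_⟩
    · simpa using hh.1.sub hρ.1
    · have := hh.2
      rwa [Matrix.trace_add, hρ.2, add_eq_left] at this
  · intro hh
    exact ⟨hρ.1.add hh.1, by rw [Matrix.trace_add, hρ.2, hh.2, add_zero]⟩

/-- Tangent vectors are limits of multiples of differences within the model, and the traceless
Hermitian matrices are closed; conversely the whole segment from `ρ` to `ρ + h` stays in the model.
-/
theorem tangentSpace_traceOneHermitian {ρ : Matrix (Fin d) (Fin d) ℂ}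
    (hρ : ρ ∈ traceOneHermitian d) :
    tangentSpace (traceOneHermitian d) ρ = tracelessHermitian d := by
  refine le_antisymm (Submodule.span_le.2 fun y hy => ?_) fun h hh => Submodule.subset_span ?_
  · obtain ⟨α, l, hl, c, e, -, he, hlim⟩ := exists_fun_of_mem_tangentConeAt hy
    refine isClosed_tracelessHermitian.mem_of_tendsto hlim ?_
    filter_upwards [he] with n hn
    exact Submodule.smul_mem _ _ ((add_mem_traceOneHermitian_iff hρ).1 hn)
  · have h1 : segment ℝ ρ (ρ + h) ⊆ traceOneHermitian d := by
      rw [segment_eq_image']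
      rintro _ ⟨t, -, rfl⟩
      simp only [add_sub_cancel_left]
      exact (add_mem_traceOneHermitian_iff hρ).2 (Submodule.smul_mem _ _ hh)
    simpa using mem_tangentConeAt_of_segment_subset h1

variable {M : Set (Matrix (Fin d) (Fin d) ℂ)} {ρ : Matrix (Fin d) (Fin d) ℂ}

theorem tangentVector_mem
    (θ : EuclideanSpace ℝ (Fin (Module.finrank ℝ (tangentSpace M ρ)))) :
    tangentVector M ρ θ ∈ tangentSpace M ρ :=
  Submodule.sum_mem _ fun i _ => Submodule.smul_mem _ _ (tangentBasis M ρ i).2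

/-- `tangentVector` as a linear map. -/
noncomputable def tangentVectorLM (M : Set (Matrix (Fin d) (Fin d) ℂ)) (ρ : Matrix (Fin d) (Fin d) ℂ) :
    EuclideanSpace ℝ (Fin (Module.finrank ℝ (tangentSpace M ρ))) →ₗ[ℝ]
      Matrix (Fin d) (Fin d) ℂ where
  toFun := tangentVector M ρ
  map_add' := fun x y => by
    simp only [tangentVector, PiLp.add_apply, add_smul, Finset.sum_add_distrib]
  map_smul' := fun c x => by
    simp only [tangentVector, PiLp.smul_apply, smul_assoc, Finset.smul_sum, RingHom.id_apply]

theorem tangentVectorLM_apply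
    (θ : EuclideanSpace ℝ (Fin (Module.finrank ℝ (tangentSpace M ρ)))) :
    tangentVectorLM M ρ θ = tangentVector M ρ θ := rfl

theorem exists_tangentVector_eq {h : Matrix (Fin d) (Fin d) ℂ} (hh : h ∈ tangentSpace M ρ) :
    ∃ θ, tangentVector M ρ θ = h := by
  refine ⟨WithLp.toLp 2 ((tangentBasis M ρ).equivFun ⟨h, hh⟩), ?_⟩
  have := congrArg (tangentSpace M ρ).subtype ((tangentBasis M ρ).sum_equivFun ⟨h, hh⟩)
  rw [map_sum] at this
  exact this

theorem tangentVector_injective : Function.Injective (tangentVector M ρ) := by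
  rw [show tangentVector M ρ = tangentVectorLM M ρ from rfl, ← LinearMap.ker_eq_bot,
    LinearMap.ker_eq_bot']
  intro θ hθ
  have h1 : ∑ i, θ i • tangentBasis M ρ i = 0 := by
    refine Subtype.ext ?_
    simpa [tangentVectorLM_apply, tangentVector] using hθ
  ext i
  exact Fintype.linearIndependent_iff.1 (tangentBasis M ρ).linearIndependent _ h1 i

theorem continuous_tangentVector : Continuous (tangentVector M ρ) := by
  unfold tangentVector
  fun_prop

theorem norm_sq_le_trace {h : Matrix (Fin d) (Fin d) ℂ} (hh : h.IsHermitian) (i j : Fin d) :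
    ‖h i j‖ ^ 2 ≤ (h * h).trace.re := by
  have h1 : (h * h).trace.re = ∑ i, ∑ j, ‖h i j‖ ^ 2 := by
    simp only [Matrix.trace, Matrix.diag, Matrix.mul_apply, Complex.re_sum]
    refine Finset.sum_congr rfl fun i _ => Finset.sum_congr rfl fun j _ => ?_
    rw [← hh.apply j i, Complex.star_def, Complex.mul_conj', ← Complex.ofReal_pow,
      Complex.ofReal_re]
  rw [h1]
  exact (Finset.single_le_sum (f := fun j => ‖h i j‖ ^ 2) (fun _ _ => by positivity)
    (Finset.mem_univ j)).trans
    (Finset.single_le_sum (f := fun i => ∑ j, ‖h i j‖ ^ 2) (fun _ _ => by positivity)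
    (Finset.mem_univ i))

/-- The Hilbert-Schmidt norm controls the coordinates of a tangent vector. -/
theorem exists_norm_sq_le_trace (hM : ∀ h ∈ tangentSpace M ρ, h.IsHermitian) :
    ∃ C : ℝ, 0 ≤ C ∧ ∀ θ, ‖θ‖ ≤ C * √(tangentVector M ρ θ * tangentVector M ρ θ).trace.re := by
  -- Matrices are viewed as functions in order to carry the sup norm, which the Hilbert–Schmidt norm
  -- dominates entrywise.
  let f : EuclideanSpace ℝ (Fin (Module.finrank ℝ (tangentSpace M ρ))) →ₗ[ℝ]
    (Fin d → Fin d → ℂ) := tangentVectorLM M ρ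
  obtain ⟨K, -, hK⟩ := f.exists_antilipschitzWith
    (LinearMap.ker_eq_bot.2 (tangentVector_injective (M := M) (ρ := ρ)))
  refine ⟨K, K.2, fun θ => ?_⟩
  have h1 := hK.le_mul_dist θ 0
  rw [map_zero, dist_zero_right, dist_zero_right] at h1
  refine h1.trans (mul_le_mul_of_nonneg_left ?_ K.2)
  refine (pi_norm_le_iff_of_nonneg (Real.sqrt_nonneg _)).2 fun i =>
    (pi_norm_le_iff_of_nonneg (Real.sqrt_nonneg _)).2 fun j => Real.le_sqrt_of_sq_le ?_
  exact norm_sq_le_trace (hM _ (tangentVector_mem θ)) i j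

end Geometry

/-! ### Born rule, Fisher information and scores. -/

namespace POVM

variable {d : ℕ} {X : Type*} [MeasurableSpace X] (E : POVM d X)

/-- The Born rule as a real linear functional of the matrix. -/
noncomputable def bornLM (x : X) : Matrix (Fin d) (Fin d) ℂ →ₗ[ℝ] ℝ where
  toFun := fun σ => E.born σ x
  map_add' := fun σ τ => by simp [born, add_mul]
  map_smul' := fun c σ => by simp [born]

theorem born_add (σ τ : Matrix (Fin d) (Fin d) ℂ) (x : X) :
    E.born (σ + τ) x = E.born σ x + E.born τ x := (E.bornLM x).map_add σ τ

theorem measurable_born (σ : Matrix (Fin d) (Fin d) ℂ) : Measurable (E.born σ) := by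
  have hentry : ∀ i j, Measurable fun x => E.effect x i j := fun i j =>
    (measurable_pi_apply j).comp ((measurable_pi_apply i).comp E.measurable_effect)
  refine Complex.measurable_re.comp ?_
  simp only [Matrix.trace, Matrix.diag, Matrix.mul_apply]
  exact Finset.measurable_fun_sum _ fun i _ => Finset.measurable_fun_sum _ fun j _ =>
    (hentry j i).const_mul _

attribute [local instance] Matrix.normedAddCommGroup Matrix.normedSpace in
theorem likelihoodIsC2 {N : ℕ} (x : Fin N → X) : LikelihoodIsC2 E x := by
  unfold LikelihoodIsC2 likelihood
  exact contDiff_prod fun i _ => (E.bornLM (x i)).toContinuousLinearMap.contDiff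

variable (ρ : quantumStates d)

theorem integral_law (f : X → ℝ) :
    ∫ x, f x ∂(E.law ρ) = ∫ x, E.born ρ x * f x ∂E.refMeasure := by
  rw [law, integral_withDensity_eq_integral_toReal_smul
    (E.measurable_born ρ).ennreal_ofReal (Eventually.of_forall fun x => ENNReal.ofReal_lt_top)]
  refine integral_congr_ae (Eventually.of_forall fun x => ?_)
  simp only [ENNReal.toReal_ofReal (E.born_nonneg ρ x), smul_eq_mul]

theorem ae_law_born_pos : ∀ᵐ x ∂(E.law ρ), 0 < E.born ρ x := by
  rw [law, ae_withDensity_iff (E.measurable_born ρ).ennreal_ofReal]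
  exact Eventually.of_forall fun x hx => by simpa using hx

theorem ae_sampleLaw_born_pos : ∀ᵐ ω ∂(E.sampleLaw ρ), ∀ i : ℕ, 0 < E.born ρ (ω i) :=
  ae_all_iff.2 fun i => (measurePreserving_eval_infinitePi
    (fun _ : ℕ => E.law (ρ : Matrix (Fin d) (Fin d) ℂ)) i).quasiMeasurePreserving.ae
      (E.ae_law_born_pos ρ)

variable {ρ}

/-- The convention `a / 0 = ∞` makes the information infinite otherwise. This is what admits states
that are not of full rank. -/
theorem ae_born_eq_zero {h : Matrix (Fin d) (Fin d) ℂ} (hfin : E.fisherInfo ρ h < ∞) :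
    ∀ᵐ x ∂E.refMeasure, E.born ρ x = 0 → E.born h x = 0 := by
  have hm : Measurable fun x => ENNReal.ofReal (E.born h x ^ 2) / ENNReal.ofReal (E.born ρ x) :=
    ((E.measurable_born h).pow_const 2).ennreal_ofReal.div (E.measurable_born ρ).ennreal_ofReal
  filter_upwards [ae_lt_top hm hfin.ne] with x hx h0
  by_contra hne
  rw [h0, ENNReal.ofReal_zero, ENNReal.div_zero] at hx
  · exact lt_irrefl _ hx
  · exact (ENNReal.ofReal_pos.2 (by positivity)).ne'

theorem fisherInfo_eq_lintegral {h : Matrix (Fin d) (Fin d) ℂ} (hfin : E.fisherInfo ρ h < ∞) :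
    E.fisherInfo ρ h =
      ∫⁻ x, ENNReal.ofReal (E.born h x * E.born h x / E.born ρ x) ∂E.refMeasure := by
  refine lintegral_congr_ae ?_
  filter_upwards [E.ae_born_eq_zero hfin] with x hx
  rcases (E.born_nonneg ρ x).eq_or_lt with h0 | h0
  · simp [hx h0.symm]
  · rw [ENNReal.ofReal_div_of_pos h0, sq]

theorem fisherForm_self_pos {h : Matrix (Fin d) (Fin d) ℂ} (hpos : 0 < E.fisherInfo ρ h)
    (hfin : E.fisherInfo ρ h < ∞) : 0 < E.fisherForm ρ h h := by
  rw [E.fisherInfo_eq_lintegral hfin] at hpos hfin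
  have hnn : ∀ x, 0 ≤ E.born h x * E.born h x / E.born ρ x := fun x =>
    div_nonneg (mul_self_nonneg _) (E.born_nonneg ρ x)
  rw [fisherForm, integral_eq_lintegral_of_nonneg_ae (Eventually.of_forall hnn)
    (((E.measurable_born h).mul (E.measurable_born h)).div
      (E.measurable_born ρ)).aestronglyMeasurable]
  exact ENNReal.toReal_pos hpos.ne' hfin.ne

theorem memLp_born_div {h : Matrix (Fin d) (Fin d) ℂ} (hfin : E.fisherInfo ρ h < ∞) :
    MemLp (fun x => E.born h x / E.born ρ x) 2 (E.law ρ) := by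
  have hm : Measurable fun x => E.born h x / E.born ρ x :=
    (E.measurable_born h).div (E.measurable_born ρ)
  rw [memLp_two_iff_integrable_sq hm.aestronglyMeasurable]
  refine ⟨(hm.pow_const 2).aestronglyMeasurable, ?_⟩
  rw [hasFiniteIntegral_iff_ofReal (Eventually.of_forall fun x => sq_nonneg _), law,
    lintegral_withDensity_eq_lintegral_mul _ (E.measurable_born ρ).ennreal_ofReal
      (hm.pow_const 2).ennreal_ofReal]
  refine lt_of_le_of_lt (lintegral_mono fun x => ?_) hfin
  rcases (E.born_nonneg ρ x).eq_or_lt with h0 | h0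
  · simp [← h0]
  · rw [Pi.mul_apply, ← ENNReal.ofReal_mul h0.le, ← ENNReal.ofReal_div_of_pos h0]
    refine le_of_eq (congrArg _ ?_)
    field_simp

/-- The law sees only outcomes of positive density; `ae_born_eq_zero` lets the integral of `Tr(h
Eₓ)` extend to all outcomes, where it equals the trace of `h`. -/
theorem integral_born_div {h : Matrix (Fin d) (Fin d) ℂ} (hfin : E.fisherInfo ρ h < ∞)
    (h0 : h.trace = 0) : ∫ x, E.born h x / E.born ρ x ∂(E.law ρ) = 0 := by
  rw [E.integral_law]
  have h1 : ∫ x, E.born ρ x * (E.born h x / E.born ρ x) ∂E.refMeasure =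
      ∫ x, E.born h x ∂E.refMeasure := by
    refine integral_congr_ae ?_
    filter_upwards [E.ae_born_eq_zero hfin] with x hx
    by_cases hp : E.born ρ x = 0
    · simp [hp, hx hp]
    · exact mul_div_cancel₀ _ hp
  rw [h1, E.integral_born, h0, Complex.zero_re]

theorem integral_born_div_mul_born_div (h k : Matrix (Fin d) (Fin d) ℂ) :
    ∫ x, E.born h x / E.born ρ x * (E.born k x / E.born ρ x) ∂(E.law ρ) = E.fisherForm ρ h k := by
  rw [E.integral_law]
  refine integral_congr_ae (Eventually.of_forall fun x => ?_)
  by_cases hp : E.born ρ x = 0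
  · simp [hp]
  · simp only
    field_simp

end POVM

open scoped RealInnerProductSpace

namespace POVM

variable {d : ℕ} {X : Type*} [MeasurableSpace X] (E : POVM d X)

/-- The score of the model `M` at `ρ`, in the coordinates `tangentBasis`. -/
noncomputable def score (M : Set (Matrix (Fin d) (Fin d) ℂ)) (ρ : Matrix (Fin d) (Fin d) ℂ)
    (x : X) : EuclideanSpace ℝ (Fin (Module.finrank ℝ (tangentSpace M ρ))) :=
  WithLp.toLp 2 fun i => E.born (tangentBasis M ρ i) x / E.born ρ x

variable {M : Set (Matrix (Fin d) (Fin d) ℂ)} {ρ : quantumStates d}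

theorem inner_score (x : X)
    (θ : EuclideanSpace ℝ (Fin (Module.finrank ℝ (tangentSpace M ρ)))) :
    ⟪E.score M ρ x, θ⟫ = E.born (tangentVector M ρ θ) x / E.born ρ x := by
  have h : E.born (tangentVector M ρ θ) x =
      ∑ i, θ i * E.born (tangentBasis M (ρ : Matrix (Fin d) (Fin d) ℂ) i) x := by
    change E.bornLM x (∑ i, θ i • (tangentBasis M (ρ : Matrix (Fin d) (Fin d) ℂ) i :
      Matrix (Fin d) (Fin d) ℂ)) = _
    rw [map_sum]
    exact Finset.sum_congr rfl fun i _ => by rw [map_smul, smul_eq_mul]; rfl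
  rw [h, Finset.sum_div, PiLp.inner_apply]
  refine Finset.sum_congr rfl fun i _ => ?_
  simp only [score, RCLike.inner_apply, conj_trivial]
  ring

theorem born_add_tangentVector {x : X} (hx : 0 < E.born ρ x)
    (θ : EuclideanSpace ℝ (Fin (Module.finrank ℝ (tangentSpace M ρ)))) :
    E.born (ρ + tangentVector M ρ θ) x = E.born ρ x * (1 + ⟪E.score M ρ x, θ⟫) := by
  rw [E.born_add, inner_score]
  field_simp

theorem measurable_score : Measurable (E.score M ρ) :=
  (WithLp.measurable_toLp 2 _).comp (measurable_pi_lambda _ fun _ =>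
    (E.measurable_born _).div (E.measurable_born ρ))

theorem fisherInfo_tangentVector_lt_top
    (hreg : ∀ h ∈ tangentSpace M ρ, h ≠ 0 → 0 < E.fisherInfo ρ h ∧ E.fisherInfo ρ h < ∞)
    {h : Matrix (Fin d) (Fin d) ℂ} (hh : h ∈ tangentSpace M ρ) : E.fisherInfo ρ h < ∞ := by
  rcases eq_or_ne h 0 with rfl | h0
  · simp [fisherInfo, born]
  · exact (hreg h hh h0).2

theorem memLp_score
    (hreg : ∀ h ∈ tangentSpace M ρ, h ≠ 0 → 0 < E.fisherInfo ρ h ∧ E.fisherInfo ρ h < ∞) :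
    MemLp (E.score M ρ) 2 (E.law ρ) :=
  MemLp.of_eval_piLp fun i => E.memLp_born_div
    (E.fisherInfo_tangentVector_lt_top hreg (tangentBasis M ρ i).2)

theorem integral_score
    (hreg : ∀ h ∈ tangentSpace M ρ, h ≠ 0 → 0 < E.fisherInfo ρ h ∧ E.fisherInfo ρ h < ∞)
    (htr : ∀ h ∈ tangentSpace M ρ, h.trace = 0) :
    ∫ x, E.score M ρ x ∂(E.law ρ) = 0 := by
  have hi := (E.memLp_score hreg).integrable (by norm_num)
  refine ext_inner_left ℝ fun θ => ?_
  rw [← integral_inner hi, inner_zero_right, ← E.integral_born_div (h := tangentVector M ρ θ)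
    (E.fisherInfo_tangentVector_lt_top hreg (tangentVector_mem θ)) (htr _ (tangentVector_mem θ))]
  refine integral_congr_ae (Eventually.of_forall fun x => ?_)
  simp only
  rw [real_inner_comm, inner_score]

theorem inner_fisherMatrix
    (hreg : ∀ h ∈ tangentSpace M ρ, h ≠ 0 → 0 < E.fisherInfo ρ h ∧ E.fisherInfo ρ h < ∞)
    (θ η : EuclideanSpace ℝ (Fin (Module.finrank ℝ (tangentSpace M ρ)))) :
    ⟪θ, Matrix.toEuclideanCLM (𝕜 := ℝ) (fisherMatrix E M ρ) η⟫ =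
      ∫ x, ⟪E.score M ρ x, θ⟫ * ⟪E.score M ρ x, η⟫ ∂(E.law ρ) := by
  set s : Fin (Module.finrank ℝ (tangentSpace M (ρ : Matrix (Fin d) (Fin d) ℂ))) → X → ℝ :=
    fun i x => E.born (tangentBasis M ρ i) x / E.born ρ x with hs
  have hint : ∀ i j, Integrable (fun x => θ i * η j * (s i x * s j x)) (E.law ρ) := fun i j =>
    ((E.memLp_born_div (E.fisherInfo_tangentVector_lt_top hreg
      (tangentBasis M ρ i).2)).integrable_mul (E.memLp_born_div
      (E.fisherInfo_tangentVector_lt_top hreg (tangentBasis M ρ j).2))).const_mul _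
  have h1 : ∀ x, ⟪E.score M ρ x, θ⟫ * ⟪E.score M ρ x, η⟫ =
      ∑ i, ∑ j, θ i * η j * (s i x * s j x) := fun x => by
    simp only [PiLp.inner_apply, Finset.sum_mul_sum]
    refine Finset.sum_congr rfl fun i _ => Finset.sum_congr rfl fun j _ => ?_
    simp only [score, hs, RCLike.inner_apply, conj_trivial]
    ring
  simp only [h1]
  rw [integral_finsetSum _ fun i _ => integrable_finsetSum _ fun j _ => hint i j,
    Matrix.inner_toEuclideanCLM]
  simp only [dotProduct, Matrix.mulVec, Finset.mul_sum]
  refine Finset.sum_congr rfl fun i _ => ?_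
  rw [integral_finsetSum _ fun j _ => hint i j]
  refine Finset.sum_congr rfl fun j _ => ?_
  rw [integral_const_mul, hs, E.integral_born_div_mul_born_div]
  simp only [fisherMatrix, Matrix.of_apply]
  ring

theorem inner_fisherMatrix_eq_fisherForm
    (hreg : ∀ h ∈ tangentSpace M ρ, h ≠ 0 → 0 < E.fisherInfo ρ h ∧ E.fisherInfo ρ h < ∞)
    (θ η : EuclideanSpace ℝ (Fin (Module.finrank ℝ (tangentSpace M ρ)))) :
    ⟪θ, Matrix.toEuclideanCLM (𝕜 := ℝ) (fisherMatrix E M ρ) η⟫ =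
      E.fisherForm ρ (tangentVector M ρ θ) (tangentVector M ρ η) := by
  rw [E.inner_fisherMatrix hreg, ← E.integral_born_div_mul_born_div]
  simp only [inner_score]

theorem posDef_fisherMatrix
    (hreg : ∀ h ∈ tangentSpace M ρ, h ≠ 0 → 0 < E.fisherInfo ρ h ∧ E.fisherInfo ρ h < ∞) :
    (fisherMatrix E M ρ).PosDef := by
  refine Matrix.PosDef.of_dotProduct_mulVec_pos ?_ fun v hv => ?_
  · ext i j
    simp only [fisherMatrix, Matrix.conjTranspose_apply, Matrix.of_apply, fisherForm, star_trivial]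
    exact integral_congr_ae (Eventually.of_forall fun x => by simp only [mul_comm])
  · have h0 : tangentVector M ρ (WithLp.toLp 2 v) ≠ 0 := fun h => hv <| by
      have := tangentVector_injective (a₂ := 0) (h.trans (tangentVectorLM M ρ).map_zero.symm)
      simpa using this
    obtain ⟨h1, h2⟩ := hreg _ (tangentVector_mem _) h0
    have h3 := E.fisherForm_self_pos h1 h2
    rw [← E.inner_fisherMatrix_eq_fisherForm hreg, Matrix.inner_toEuclideanCLM] at h3
    simpa using h3

theorem likelihood_add_tangentVector {N : ℕ} {x : Fin N → X} (hx : ∀ i, 0 < E.born ρ (x i))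
    (θ : EuclideanSpace ℝ (Fin (Module.finrank ℝ (tangentSpace M ρ)))) :
    E.likelihood x (ρ + tangentVector M ρ θ) =
      (∏ i, E.born ρ (x i)) * ∏ i, (1 + ⟪E.score M ρ (x i), θ⟫) := by
  rw [likelihood, ← Finset.prod_mul_distrib]
  exact Finset.prod_congr rfl fun i _ => E.born_add_tangentVector (hx i) θ

theorem log_likelihood_add_tangentVector {N : ℕ} {x : Fin N → X} (hx : ∀ i, 0 < E.born ρ (x i))
    {θ : EuclideanSpace ℝ (Fin (Module.finrank ℝ (tangentSpace M ρ)))}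
    (hθ : ∀ i, 0 < 1 + ⟪E.score M ρ (x i), θ⟫) :
    Real.log (E.likelihood x (ρ + tangentVector M ρ θ)) =
      Real.log (∏ i, E.born ρ (x i)) + ∑ i, Real.log (1 + ⟪E.score M ρ (x i), θ⟫) := by
  rw [E.likelihood_add_tangentVector hx, Real.log_mul (Finset.prod_pos fun i _ => hx i).ne'
    (Finset.prod_pos fun i _ => hθ i).ne', Real.log_prod fun i _ => (hθ i).ne']

/-- An interior critical point of the likelihood is the unique maximum likelihood estimate, if
the observed scores separate the directions of the model. -/
theorem isMLE_of_critical {N : ℕ} {x : Fin N → X} (hx : ∀ i, 0 < E.born ρ (x i))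
    (hM : ∀ σ, σ ∈ M ↔ ∃ θ, σ = ρ + tangentVector M ρ θ)
    {θ : EuclideanSpace ℝ (Fin (Module.finrank ℝ (tangentSpace M ρ)))}
    (hθ : ∀ i, 0 < 1 + ⟪E.score M ρ (x i), θ⟫)
    (hgrad : logGradient (fun i => E.score M ρ (x i)) θ = 0)
    (hsep : ∀ η, (∀ i, ⟪E.score M ρ (x i), η⟫ = 0) → η = 0) :
    E.IsMLE M x (ρ + tangentVector M ρ θ) ∧
      ∀ σ, E.IsMLE M x σ → σ = ρ + tangentVector M ρ θ := by
  have hp : 0 < ∏ i, E.born ρ (x i) := Finset.prod_pos fun i _ => hx i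
  have hborn : ∀ i, 0 ≤ E.born (ρ + tangentVector M ρ θ) (x i) := fun i => by
    rw [E.born_add_tangentVector (hx i)]
    exact (mul_pos (hx i) (hθ i)).le
  have hnn : ∀ η, (∀ i, 0 ≤ E.born (ρ + tangentVector M ρ η) (x i)) →
      ∀ i, 0 ≤ 1 + ⟪E.score M ρ (x i), η⟫ := fun η hη i => by
    have := hη i
    rw [E.born_add_tangentVector (hx i)] at this
    exact nonneg_of_mul_nonneg_right this (hx i)
  refine ⟨⟨⟨(hM _).2 ⟨θ, rfl⟩, hborn⟩, fun τ hτ hτ0 => ?_⟩, fun σ hσ => ?_⟩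
  · obtain ⟨η, rfl⟩ := (hM τ).1 hτ
    rw [E.likelihood_add_tangentVector hx, E.likelihood_add_tangentVector hx]
    exact mul_le_mul_of_nonneg_left (prod_one_add_inner_le hθ hgrad (hnn η hτ0)).1 hp.le
  · obtain ⟨η, rfl⟩ := (hM σ).1 hσ.1.1
    have h1 := hσ.2 _ ((hM _).2 ⟨θ, rfl⟩) hborn
    rw [E.likelihood_add_tangentVector hx, E.likelihood_add_tangentVector hx] at h1
    obtain ⟨h2, h3⟩ := prod_one_add_inner_le hθ hgrad (hnn η hσ.1.2)
    have h4 := hsep _ (h3 (h2.antisymm (le_of_mul_le_mul_left h1 hp)))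
    rw [sub_eq_zero.1 h4]

end POVM

/-! ### LAN for the unconstrained model. -/

variable {d : ℕ} {X : Type*} [MeasurableSpace X]

theorem satisfiesLAN_traceOneHermitian (E : POVM d X) (ρ : quantumStates d)
    (hρ : E.HasRegularFisherInfo ρ) : SatisfiesLAN E (traceOneHermitian d) ρ := by
  have hmem : (ρ : Matrix (Fin d) (Fin d) ℂ) ∈ traceOneHermitian d :=
    quantumStates_subset_traceOneHermitian ρ.2
  set M := traceOneHermitian d with hMdef
  have htan : tangentSpace M (ρ : Matrix (Fin d) (Fin d) ℂ) = tracelessHermitian d :=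
    tangentSpace_traceOneHermitian hmem
  have hH : ∀ h ∈ tangentSpace M (ρ : Matrix (Fin d) (Fin d) ℂ), h.IsHermitian ∧ h.trace = 0 :=
    fun h hh => by rw [htan] at hh; exact hh
  have hreg : ∀ h ∈ tangentSpace M (ρ : Matrix (Fin d) (Fin d) ℂ), h ≠ 0 →
      0 < E.fisherInfo ρ h ∧ E.fisherInfo ρ h < ∞ := fun h hh h0 =>
    hρ h (hH h hh).1 (hH h hh).2 h0
  have hM : ∀ σ, σ ∈ M ↔ ∃ θ, σ = ρ + tangentVector M ρ θ := fun σ => by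
    have h1 := add_mem_traceOneHermitian_iff (h := σ - (ρ : Matrix (Fin d) (Fin d) ℂ)) hmem
    rw [add_sub_cancel, ← htan] at h1
    rw [h1]
    refine ⟨fun h => ?_, ?_⟩
    · obtain ⟨θ, hθ⟩ := exists_tangentVector_eq h
      exact ⟨θ, by rw [hθ, add_sub_cancel]⟩
    · rintro ⟨θ, rfl⟩
      rw [add_sub_cancel_left]
      exact tangentVector_mem θ
  have hS := E.measurable_score (M := M) (ρ := ρ)
  have hS2 := E.memLp_score hreg
  have hS0 := E.integral_score hreg fun h hh => (hH h hh).2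
  have hI := E.posDef_fisherMatrix hreg
  have hcov := E.inner_fisherMatrix hreg
  set I := fisherMatrix E M (ρ : Matrix (Fin d) (Fin d) ℂ)
  set S := E.score M (ρ : Matrix (Fin d) (Fin d) ℂ)
  have hsub : ∀ θ η, (ρ + tangentVector M ρ θ) - (ρ + tangentVector M ρ η) =
      tangentVector M (ρ : Matrix (Fin d) (Fin d) ℂ) (θ - η) := fun θ η => by
    rw [add_sub_add_left_eq_sub]
    exact ((tangentVectorLM M ρ).map_sub θ η).symm
  refine ⟨subset_rfl, hmem, hreg,
    fun N x => ρ + tangentVector M ρ (newtonMLE I S N x), fun N => ?_, ?_, ?_, fun R ε hε => ?_⟩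
  · exact (continuous_const.add continuous_tangentVector).measurable.comp (measurable_newtonMLE hS N)
  · refine tendsto_of_tendsto_of_tendsto_of_le_of_le tendsto_const_nhds
      (tendsto_measure_not_critical hS hS2 hS0 hI hcov) (fun _ => zero_le) fun N => ?_
    -- The inclusion of events holds only almost surely: factoring the likelihood needs positive
    -- density at every observed outcome.
    refine measure_mono_ae ?_
    filter_upwards [E.ae_sampleLaw_born_pos ρ] with ω hω hbad hcrit
    exact hbad (E.isMLE_of_critical (fun i => hω i) hM hcrit.1 hcrit.2.1 hcrit.2.2)
  · refine ((tendstoInDistribution_newtonMLE hS hS2 hS0 hI hcov).continuous_comp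
      (g := tangentVector M (ρ : Matrix (Fin d) (Fin d) ℂ)) continuous_tangentVector).congr
      (fun N => Eventually.of_forall fun ω => ?_) .rfl
    simp only [Function.comp_apply, add_sub_cancel_left]
    exact (tangentVectorLM M ρ).map_smul _ _
  · obtain ⟨C, hC0, hC⟩ := exists_norm_sq_le_trace (M := M)
      (ρ := (ρ : Matrix (Fin d) (Fin d) ℂ)) fun h hh => (hH h hh).1
    -- The constant `C` converts the Hilbert–Schmidt radius into one for coordinates; `|R|` appears
    -- as the square root of `R ^ 2`.
    refine tendsto_of_tendsto_of_tendsto_of_le_of_le tendsto_const_nhds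
      (tendsto_measure_not_quadratic hS hS2 hS0 hI hcov (R := C * |R|) hε)
      (fun _ => zero_le) fun N => ?_
    refine measure_mono_ae ?_
    filter_upwards [E.ae_sampleLaw_born_pos ρ] with ω hω hbad hquad
    refine hbad fun σ hσ hσR => ?_
    obtain ⟨θ, rfl⟩ := (hM σ).1 hσ
    simp only [hsub] at hσR ⊢
    obtain ⟨h1, h2⟩ := hquad θ (by
      refine (mul_le_mul_of_nonneg_left (hC _) (Real.sqrt_nonneg _)).trans ?_
      rw [mul_left_comm, ← Real.sqrt_mul (Nat.cast_nonneg _)]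
      exact mul_le_mul_of_nonneg_left (Real.sqrt_le_sqrt hσR |>.trans_eq (Real.sqrt_sq_eq_abs R))
        hC0)
    refine ⟨fun i => ?_, ?_⟩
    · rw [E.born_add_tangentVector (hω i)]
      exact mul_pos (hω i) (h1 i)
    -- Positivity at the estimator is the quadratic event applied to the estimator itself, at
    -- distance zero.
    · have h3 : ∀ i : Fin N, 0 < 1 + ⟪S (ω i), newtonMLE I S N fun i => ω i⟫ := (hquad _ (by
        rw [sub_self, norm_zero, mul_zero]
        positivity)).1
      rw [E.log_likelihood_add_tangentVector (fun i => hω i) h1,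
        E.log_likelihood_add_tangentVector (fun i => hω i) h3, add_sub_add_left_eq_sub,
        ← E.inner_fisherMatrix_eq_fisherForm hreg]
      exact h2

end QuantumTomography

theorem mainTheorem2 {d : ℕ} {X : Type*} [MeasurableSpace X]
    (E : QuantumTomography.POVM d X) :
    Convex ℝ (QuantumTomography.quantumStates d) ∧
    QuantumTomography.quantumStates d ⊆ QuantumTomography.traceOneHermitian d ∧
    (∀ (N : ℕ) (x : Fin N → X), QuantumTomography.LikelihoodIsC2 E x) ∧
    ∀ ρ₀ : QuantumTomography.quantumStates d,
      E.HasRegularFisherInfo (ρ₀ : Matrix (Fin d) (Fin d) ℂ) →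
        QuantumTomography.SatisfiesLAN E (QuantumTomography.traceOneHermitian d) ρ₀ ∧
        QuantumTomography.SatisfiesMPLAN E (QuantumTomography.quantumStates d) ρ₀ := by
  refine ⟨QuantumTomography.convex_quantumStates,
    QuantumTomography.quantumStates_subset_traceOneHermitian, fun N x => E.likelihoodIsC2 x,
    fun ρ₀ hρ₀ => ?_⟩
  have h := QuantumTomography.satisfiesLAN_traceOneHermitian E ρ₀ hρ₀
  exact ⟨h, ρ₀.2, QuantumTomography.convex_quantumStates, _,
    QuantumTomography.quantumStates_subset_traceOneHermitian, h⟩
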